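/- For a finite bit string $\mathbf{x}$ and $q\in(0,1)$, let $\mathcal{D}_{\mathbf{x}}$ be the law of the trace of $\mathbf{x}$, that is, of the random string obtained from $\mathbf{x}$ by deleting each bit independently with probability $q$ and concatenating the retained bits in their original order. For $n\ge 1$ let $$\mathbf{x}_n := (01)^{n-1}\,10\,(01)^n,\qquad \mathbf{y}_n := (01)^n\,10\,(01)^{n-1},$$ which are bit strings of length $4n$, where $(01)^m$ is the string consisting of $m$ consecutive copies of $01$. Let $d_{\mathrm{TV}}(\mu,\nu):=\frac12\sum_{s}|\mu(s)-\nu(s)|$ be the total variation distance between probability measures on the countable set of finite bit strings. Then for every $q\in(0,1)$ there is a constant $C>0$, depending only on $q$, such that $$d_{\mathrm{TV}}(\mathcal{D}_{\mathbf{x}_n},\mathcal{D}_{\mathbf{y}_n})\le C\,n^{-3/4}\qquad\text{for all } n\ge 1,$$ and $$C^{-1}\,n^{-3/4}(\log n)^{-1/2}\le d_{\mathrm{TV}}(\mathcal{D}_{\mathbf{x}_n},\mathcal{D}_{\mathbf{y}_n})\qquad\text{for all } n\ge 2.$$ -/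

import Mathlib

open scoped NNReal

noncomputable section

namespace TraceReconstruction

/-- The law of the decision to delete one bit: `true` (delete) with probability `q`, `false`
(retain) with probability `1 - q`. -/
def deletionCoin (q : ℝ≥0) (hq : q ≤ 1) : PMF Bool :=
  PMF.ofFintype (fun deleted => if deleted then (q : ENNReal) else ((1 - q : ℝ≥0) : ENNReal)) (by
    simp only [Fintype.sum_bool, if_true, Bool.false_eq_true, if_false]
    rw [← ENNReal.coe_add, add_tsub_cancel_of_le hq, ENNReal.coe_one])

/-- The law of the trace of a bit string sent through the deletion channel with deletion
probability `q`: each bit, independently of the others, is deleted with probability `q` and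
retained with probability `1 - q`; the retained bits are listed in their original order.
The bit `0` is `false` and the bit `1` is `true`. -/
def traceLaw (q : ℝ≥0) (hq : q ≤ 1) : List Bool → PMF (List Bool)
  | [] => PMF.pure []
  | b :: x =>
    (deletionCoin q hq).bind fun deleted =>
      (traceLaw q hq x).map fun t => if deleted then t else b :: t

/-- The string `(01)^m` of length `2 m`. -/
def zeroOnePow (m : ℕ) : List Bool :=
  (List.replicate m [false, true]).flatten

/-- The string `x_n = (01)^(n-1) 10 (01)^n`, for `n ≥ 1`. -/
def xString (n : ℕ) : List Bool :=
  zeroOnePow (n - 1) ++ [true, false] ++ zeroOnePow n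

/-- The string `y_n = (01)^n 10 (01)^(n-1)`, for `n ≥ 1`. -/
def yString (n : ℕ) : List Bool :=
  zeroOnePow n ++ [true, false] ++ zeroOnePow (n - 1)

/-- Total variation distance of two discrete probability measures: half the `ℓ¹` distance of
their mass functions (the sum always converges, being bounded by `2`). -/
def tvDist {α : Type*} (μ ν : PMF α) : ℝ :=
  (1 / 2) * ∑' a, |(μ a).toReal - (ν a).toReal|

end TraceReconstruction

end

/-! The traces of `10` and `01` differ in law only when both bits survive. Replacing the defect `10`
by `01` turns both strings into the same alternating string, so the difference of the two trace laws
is `(1-q)^2` times a commutator: `01` minus `10`, inserted between traces of `(01)^(n+1)` and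
`(01)^n`, minus the same with these two lengths exchanged (`traceExp_xString_sub_yString`).

Upper bound. The trace of `(01)^n` is a concatenation of a binomial number of iid nonempty blocks.
With `i` blocks before the insertion and `j` after, the commutator has antisymmetric coefficients
`commCoeff`, which sum to zero on each antidiagonal `i + j = L`. Inserting a marked letter at a
random place in an iid word, with zero-sum coefficients, is integrating against a martingale sum, so
it costs the ℓ² norm of the coefficients and not the ℓ¹ norm (`exists_abs_sum_defectExp_le`). The
coefficients are of order `n^(-3/2)` on a window of side `√n`; summing ℓ² norms over about `√n`
antidiagonals gives `n^(1/2) * n^(1/4) * n^(-3/2) = n^(-3/4)`.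

Lower bound. The test statistic is a sum of centred indicators that consecutive bits differ,
weighted by a tent of width and height of order `√n`. Away from the defect it is a martingale sum,
subgaussian at scale `n^(3/4)` (`traceExp_exp_patSum_defect_le`). The ramp of the tent sits where
the defect lands in the trace, so moving the defect by one period shifts the mean by at least a
constant (`exists_traceExp_tent_sub_ge`). Truncating the statistic at `n^(3/4) * √(log n)` makes its
tails negligible, and the gap in means forces the distance to be at least of order `n^(-3/4) * (log
n)^(-1/2)`. -/

namespace TraceReconstruction

/-! ### Trace expectations and total variation. -/

/-- The expectation of `f` under the law of the trace of a bit string. -/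
noncomputable def traceExp (q : ℝ) : List Bool → (List Bool → ℝ) →ₗ[ℝ] ℝ
  | [] => LinearMap.proj []
  | b :: x => q • traceExp q x +
      (1 - q) • (traceExp q x ∘ₗ LinearMap.funLeft ℝ ℝ (List.cons b))

section traceExp

variable {q : ℝ}

@[simp] lemma traceExp_nil (f : List Bool → ℝ) : traceExp q [] f = f [] := rfl

lemma traceExp_cons (b : Bool) (x : List Bool) (f : List Bool → ℝ) :
    traceExp q (b :: x) f =
      q * traceExp q x f + (1 - q) * traceExp q x (fun t => f (b :: t)) := rfl

lemma traceExp_add (x : List Bool) (f g : List Bool → ℝ) :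
    traceExp q x (fun t => f t + g t) = traceExp q x f + traceExp q x g := map_add _ f g

lemma traceExp_sub (x : List Bool) (f g : List Bool → ℝ) :
    traceExp q x (fun t => f t - g t) = traceExp q x f - traceExp q x g := map_sub _ f g

lemma traceExp_mul (x : List Bool) (c : ℝ) (f : List Bool → ℝ) :
    traceExp q x (fun t => c * f t) = c * traceExp q x f := map_smul _ c f

lemma traceExp_const (x : List Bool) (c : ℝ) : traceExp q x (fun _ => c) = c := by
  induction x with
  | nil => rfl
  | cons b x ih => rw [traceExp_cons, ih]; ring

lemma traceExp_append (x y : List Bool) (f : List Bool → ℝ) :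
    traceExp q (x ++ y) f = traceExp q x (fun u => traceExp q y (fun v => f (u ++ v))) := by
  induction x generalizing f with
  | nil => rfl
  | cons b x ih => simp only [List.cons_append, traceExp_cons, ih]

lemma traceExp_mono (h0 : 0 ≤ q) (h1 : q ≤ 1) (x : List Bool) {f g : List Bool → ℝ}
    (h : ∀ s, f s ≤ g s) : traceExp q x f ≤ traceExp q x g := by
  induction x generalizing f g with
  | nil => exact h _
  | cons b x ih =>
    rw [traceExp_cons, traceExp_cons]
    have := ih h
    have := ih (f := fun t => f (b :: t)) (g := fun t => g (b :: t)) fun s => h _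
    have : 0 ≤ 1 - q := by linarith
    gcongr

lemma traceExp_nonneg (h0 : 0 ≤ q) (h1 : q ≤ 1) (x : List Bool) {f : List Bool → ℝ}
    (h : ∀ s, 0 ≤ f s) : 0 ≤ traceExp q x f := by
  rw [← traceExp_const (q := q) x 0]
  exact traceExp_mono h0 h1 x h

lemma traceExp_congr (x : List Bool) {f g : List Bool → ℝ}
    (h : ∀ s, s.Sublist x → f s = g s) : traceExp q x f = traceExp q x g := by
  induction x generalizing f g with
  | nil => exact h _ (List.Sublist.refl _)
  | cons b x ih =>
    rw [traceExp_cons, traceExp_cons, ih fun s hs => h s (hs.cons b),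
      ih (f := fun t => f (b :: t)) (g := fun t => g (b :: t)) fun s hs => h _ (hs.cons_cons b)]

/-- The probability that the trace of `x` is `s`. -/
noncomputable def traceMass (q : ℝ) (x s : List Bool) : ℝ :=
  traceExp q x (fun t => if t = s then 1 else 0)

lemma traceMass_nonneg (h0 : 0 ≤ q) (h1 : q ≤ 1) (x s : List Bool) : 0 ≤ traceMass q x s :=
  traceExp_nonneg h0 h1 x fun t => by split_ifs <;> norm_num

lemma traceMass_eq_zero {x s : List Bool} (h : ¬ s.Sublist x) : traceMass q x s = 0 := by
  rw [← traceExp_const (q := q) x 0]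
  refine traceExp_congr x fun t ht => if_neg ?_
  rintro rfl
  exact h ht

lemma traceExp_eq_sum (x : List Bool) (S : Finset (List Bool)) (hS : ∀ s, s.Sublist x → s ∈ S)
    (f : List Bool → ℝ) : traceExp q x f = ∑ s ∈ S, traceMass q x s * f s := by
  have : traceExp q x f = traceExp q x (∑ s ∈ S, f s • fun t => if t = s then (1 : ℝ) else 0) := by
    refine traceExp_congr x fun t ht => ?_
    simp [Finset.sum_apply, hS t ht]
  rw [this, map_sum]
  refine Finset.sum_congr rfl fun s _ => ?_
  rw [map_smul, smul_eq_mul, mul_comm]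
  rfl

lemma traceMass_cons (b : Bool) (x s : List Bool) :
    traceMass q (b :: x) s = q * traceMass q x s + (1 - q) *
      (match s with
        | [] => 0
        | c :: t => if b = c then traceMass q x t else 0) := by
  rw [traceMass, traceExp_cons]
  congr 2
  cases s with
  | nil => simpa using traceExp_const (q := q) x 0
  | cons c t =>
    by_cases h : b = c
    · simp [h, traceMass]
    · simpa [h] using traceExp_const (q := q) x 0

lemma traceMass_of_length_eq (x s : List Bool) (h : s.length = x.length) :
    traceMass q x s = if s = x then (1 - q) ^ x.length else 0 := by
  split_ifs with hs
  · subst hs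
    induction s with
    | nil => simp [traceMass]
    | cons b x ih =>
      rw [traceMass_cons, traceMass_eq_zero, List.length_cons, pow_succ]
      · simp only [if_true, ih rfl]
        ring
      · intro h
        have := h.length_le
        simp at this
  · exact traceMass_eq_zero fun h' => hs (h'.eq_of_length h)

end traceExp

lemma traceLaw_apply (q : ℝ≥0) (hq : q ≤ 1) (x s : List Bool) :
    traceLaw q hq x s = ENNReal.ofReal (traceMass q x s) := by
  have h0 : (0 : ℝ) ≤ q := q.2
  have h1 : (q : ℝ) ≤ 1 := by exact_mod_cast hq
  induction x generalizing s with
  | nil =>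
    by_cases h : s = []
    · simp [traceLaw, traceMass, h]
    · simp [traceLaw, traceMass, PMF.pure_apply, h, Ne.symm h]
  | cons b x ih =>
    have hp : ((1 - q : ℝ≥0) : ENNReal) = ENNReal.ofReal (1 - q) := by
      rw [← ENNReal.ofReal_coe_nnreal, NNReal.coe_sub hq, NNReal.coe_one]
    have hid : (traceLaw q hq x).map (fun t => if true = true then t else b :: t) =
        traceLaw q hq x := by
      simp only [if_true]
      exact PMF.map_id (traceLaw q hq x)
    have hmap : (traceLaw q hq x).map (fun t => if false = true then t else b :: t) s =
        ENNReal.ofReal (match s with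
        | [] => 0
        | c :: t => if b = c then traceMass q x t else 0) := by
      rw [PMF.map_apply]
      cases s with
      | nil => simp
      | cons c t =>
        by_cases hbc : b = c
        · subst hbc
          rw [tsum_eq_single t]
          · simp [ih]
          · intro t' ht'
            simp [Ne.symm ht']
        · simp [hbc, Ne.symm hbc]
    have hnn : 0 ≤ (match s with
        | [] => 0
        | c :: t => if b = c then traceMass (q : ℝ) x t else 0) := by
      split
      · exact le_rfl
      · split_ifs
        · exact traceMass_nonneg h0 h1 _ _
        · exact le_rfl
    rw [traceLaw, PMF.bind_apply, tsum_bool, hid, hmap, ih, traceMass_cons, add_comm,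
      ENNReal.ofReal_add (mul_nonneg h0 (traceMass_nonneg h0 h1 _ _))
        (mul_nonneg (by linarith) hnn), ENNReal.ofReal_mul h0, ENNReal.ofReal_mul (by linarith)]
    simp [deletionCoin, hp]

lemma tvDist_eq_sum (q : ℝ≥0) (hq : q ≤ 1) (x y : List Bool) (S : Finset (List Bool))
    (hx : ∀ s, s.Sublist x → s ∈ S) (hy : ∀ s, s.Sublist y → s ∈ S) :
    tvDist (traceLaw q hq x) (traceLaw q hq y) =
      1 / 2 * ∑ s ∈ S, |traceMass q x s - traceMass q y s| := by
  have h0 : (0 : ℝ) ≤ q := q.2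
  have h1 : (q : ℝ) ≤ 1 := by exact_mod_cast hq
  rw [tvDist]
  congr 1
  simp only [traceLaw_apply, ENNReal.toReal_ofReal (traceMass_nonneg h0 h1 _ _)]
  refine tsum_eq_sum (s := S) fun s hs => ?_
  rw [traceMass_eq_zero fun h => hs (hx s h), traceMass_eq_zero fun h => hs (hy s h)]
  simp

lemma exists_finset_sublist (x y : List Bool) :
    ∃ S : Finset (List Bool), (∀ s, s.Sublist x → s ∈ S) ∧ ∀ s, s.Sublist y → s ∈ S :=
  ⟨x.sublists.toFinset ∪ y.sublists.toFinset,
    fun s hs => by simp [hs], fun s hs => by simp [hs]⟩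

lemma tvDist_le_of_forall (q : ℝ≥0) (hq : q ≤ 1) (x y : List Bool) (ε : ℝ)
    (h : ∀ f : List Bool → ℝ, (∀ s, |f s| ≤ 1) → traceExp q x f - traceExp q y f ≤ ε) :
    tvDist (traceLaw q hq x) (traceLaw q hq y) ≤ 1 / 2 * ε := by
  obtain ⟨S, hx, hy⟩ := exists_finset_sublist x y
  rw [tvDist_eq_sum q hq x y S hx hy]
  gcongr
  refine le_of_eq_of_le ?_
    (h (fun s => (SignType.sign (traceMass (q : ℝ) x s - traceMass q y s) : ℝ)) ?_)
  · rw [traceExp_eq_sum x S hx, traceExp_eq_sum y S hy, ← Finset.sum_sub_distrib]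
    refine Finset.sum_congr rfl fun s _ => ?_
    rw [← sub_mul, self_mul_sign]
  · intro s
    rcases lt_trichotomy (traceMass (q : ℝ) x s - traceMass q y s) 0 with h | h | h <;> simp [h]

/-- Duality for unbounded test functions: the part of `f` beyond the level `c` is dominated by `k`
and charged to each law separately. -/
lemma traceExp_sub_le_tvDist (q : ℝ≥0) (hq : q ≤ 1) (x y : List Bool) (f k : List Bool → ℝ)
    (c : ℝ) (hk : ∀ s, 0 ≤ k s) (hf : ∀ s, |f s| ≤ c + k s) :
    traceExp q x f - traceExp q y f ≤
      2 * c * tvDist (traceLaw q hq x) (traceLaw q hq y) + traceExp q x k + traceExp q y k := by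
  obtain ⟨S, hx, hy⟩ := exists_finset_sublist x y
  have h0 : (0 : ℝ) ≤ q := q.2
  have h1 : (q : ℝ) ≤ 1 := by exact_mod_cast hq
  rw [tvDist_eq_sum q hq x y S hx hy, traceExp_eq_sum x S hx, traceExp_eq_sum y S hy,
    traceExp_eq_sum x S hx, traceExp_eq_sum y S hy, ← Finset.sum_sub_distrib,
    show 2 * c * (1 / 2 * ∑ s ∈ S, |traceMass (q : ℝ) x s - traceMass q y s|) =
      c * ∑ s ∈ S, |traceMass (q : ℝ) x s - traceMass q y s| by ring, Finset.mul_sum,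
    ← Finset.sum_add_distrib, ← Finset.sum_add_distrib]
  refine Finset.sum_le_sum fun s _ => ?_
  have hX := traceMass_nonneg h0 h1 x s
  have hY := traceMass_nonneg h0 h1 y s
  set X := traceMass (q : ℝ) x s
  set Y := traceMass (q : ℝ) y s
  calc X * f s - Y * f s = (X - Y) * f s := by ring
    _ ≤ |X - Y| * |f s| := by rw [← abs_mul]; exact le_abs_self _
    _ ≤ |X - Y| * (c + k s) := by gcongr; exact hf s
    _ = c * |X - Y| + |X - Y| * k s := by ring
    _ ≤ c * |X - Y| + (X + Y) * k s := by
        have := hk s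
        gcongr
        exact abs_le.2 ⟨by linarith, by linarith⟩
    _ = c * |X - Y| + X * k s + Y * k s := by ring

/-! ### The two strings and the commutator formula. -/

lemma zeroOnePow_succ (n : ℕ) : zeroOnePow (n + 1) = [false, true] ++ zeroOnePow n := by
  simp [zeroOnePow, List.replicate_succ]

lemma zeroOnePow_add (m n : ℕ) : zeroOnePow (m + n) = zeroOnePow m ++ zeroOnePow n := by
  rw [zeroOnePow, zeroOnePow, zeroOnePow, ← List.flatten_append, List.replicate_append_replicate]

lemma zeroOnePow_succ' (n : ℕ) : zeroOnePow (n + 1) = zeroOnePow n ++ [false, true] := by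
  rw [zeroOnePow_add]; rfl

lemma length_zeroOnePow (n : ℕ) : (zeroOnePow n).length = 2 * n := by
  induction n with
  | zero => rfl
  | succ n ih => rw [zeroOnePow_succ, List.length_append, ih]; simp; ring

lemma xString_ne_yString (n : ℕ) : xString (n + 1) ≠ yString (n + 1) := by
  rw [xString, yString, Nat.add_sub_cancel, zeroOnePow_succ', List.append_assoc,
    List.append_assoc, List.append_assoc]
  intro h
  simpa using List.append_cancel_left h

lemma length_xString (n : ℕ) : (xString (n + 1)).length = 4 * (n + 1) := by
  simp only [xString, List.length_append, length_zeroOnePow, Nat.add_sub_cancel]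
  simp; ring

lemma length_yString (n : ℕ) : (yString (n + 1)).length = 4 * (n + 1) := by
  simp only [yString, List.length_append, length_zeroOnePow, Nat.add_sub_cancel]
  simp; ring

/-- The full string `x` is a trace of `x` with positive probability, but never of the different
string `y` of equal length. This serves the finitely many small `n` in the lower bound. -/
lemma tvDist_xString_yString_pos (q : ℝ≥0) (hq : q < 1) (n : ℕ) :
    0 < tvDist (traceLaw q hq.le (xString (n + 1))) (traceLaw q hq.le (yString (n + 1))) := by
  have h1 : (q : ℝ) < 1 := by exact_mod_cast hq
  have h := traceExp_sub_le_tvDist q hq.le (xString (n + 1)) (yString (n + 1))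
    (fun t => if t = xString (n + 1) then 1 else 0) (fun _ => 0) 1 (fun _ => le_rfl)
    (fun s => by split_ifs <;> simp)
  change traceMass _ _ _ - traceMass _ _ _ ≤ _ at h
  rw [traceMass_of_length_eq _ _ rfl, if_pos rfl,
    traceMass_of_length_eq _ _ (by rw [length_xString, length_yString]),
    if_neg (xString_ne_yString n), traceExp_const, traceExp_const] at h
  have : 0 < (1 - (q : ℝ)) ^ (xString (n + 1)).length := pow_pos (by linarith) _
  linarith

/-- The difference of the two trace laws, expressed through the commutator of `01` and `10`. -/
lemma traceExp_xString_sub_yString (q : ℝ) (n : ℕ) (f : List Bool → ℝ) :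
    traceExp q (xString (n + 1)) f - traceExp q (yString (n + 1)) f =
      (1 - q) ^ 2 *
        (traceExp q (zeroOnePow (n + 1)) (fun u => traceExp q (zeroOnePow n) (fun v =>
            f (u ++ false :: true :: v) - f (u ++ true :: false :: v))) -
          traceExp q (zeroOnePow n) (fun u => traceExp q (zeroOnePow (n + 1)) (fun v =>
            f (u ++ false :: true :: v) - f (u ++ true :: false :: v)))) := by
  -- Swap the defect `10` for `01`: traces with at most one surviving bit of the pair cancel, which
  -- leaves the factor `(1 - q)^2`. For both strings the swapped string is the same.
  have key : ∀ a b : ℕ, traceExp q (zeroOnePow a ++ [true, false] ++ zeroOnePow b) f =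
      traceExp q (zeroOnePow (a + 1 + b)) f -
        (1 - q) ^ 2 * traceExp q (zeroOnePow a) (fun u => traceExp q (zeroOnePow b) (fun v =>
            f (u ++ false :: true :: v) - f (u ++ true :: false :: v))) := by
    intro a b
    rw [zeroOnePow_add (a + 1) b, zeroOnePow_succ', traceExp_append, traceExp_append,
      traceExp_append, traceExp_append, ← traceExp_mul, ← traceExp_sub]
    congr 1
    funext u
    simp only [traceExp_cons, traceExp_nil, traceExp_sub, List.append_assoc, List.nil_append,
      List.cons_append]
    ring
  rw [xString, yString, Nat.add_sub_cancel, key, key, show n + 1 + 1 + n = n + 1 + (n + 1) by ring]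
  ring

end TraceReconstruction

/-! ### Binomial weights and moments. -/

namespace TraceReconstruction

/-- The binomial weight. -/
noncomputable def binWeight (θ : ℝ) (n i : ℕ) : ℝ := n.choose i * θ ^ i * (1 - θ) ^ (n - i)

/-- The expectation of `f` under the binomial law with parameters `n` and `θ`. -/
noncomputable def binExp (θ : ℝ) : ℕ → (ℕ → ℝ) →ₗ[ℝ] ℝ
  | 0 => LinearMap.proj 0
  | n + 1 => (1 - θ) • binExp θ n + θ • (binExp θ n ∘ₗ LinearMap.funLeft ℝ ℝ Nat.succ)

variable {θ : ℝ}

@[simp] lemma binExp_zero (f : ℕ → ℝ) : binExp θ 0 f = f 0 := rfl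

lemma binExp_succ (n : ℕ) (f : ℕ → ℝ) :
    binExp θ (n + 1) f = (1 - θ) * binExp θ n f + θ * binExp θ n (fun i => f (i + 1)) := rfl

lemma binExp_add (n : ℕ) (f g : ℕ → ℝ) :
    binExp θ n (fun t => f t + g t) = binExp θ n f + binExp θ n g := map_add _ f g

lemma binExp_sub (n : ℕ) (f g : ℕ → ℝ) :
    binExp θ n (fun t => f t - g t) = binExp θ n f - binExp θ n g := map_sub _ f g

lemma binExp_mul (n : ℕ) (c : ℝ) (f : ℕ → ℝ) :
    binExp θ n (fun t => c * f t) = c * binExp θ n f := map_smul _ c f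

lemma binExp_const (n : ℕ) (c : ℝ) : binExp θ n (fun _ => c) = c := by
  induction n with
  | zero => rfl
  | succ n ih => rw [binExp_succ, ih]; ring

lemma binExp_mono (h0 : 0 ≤ θ) (h1 : θ ≤ 1) (n : ℕ) {f g : ℕ → ℝ} (h : ∀ i, f i ≤ g i) :
    binExp θ n f ≤ binExp θ n g := by
  induction n generalizing f g with
  | zero => exact h _
  | succ n ih =>
    rw [binExp_succ, binExp_succ]
    have := ih h
    have := ih (f := fun t => f (t + 1)) (g := fun t => g (t + 1)) fun s => h _
    have : 0 ≤ 1 - θ := by linarith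
    gcongr

lemma traceExp_length (q : ℝ) (x : List Bool) (f : ℕ → ℝ) :
    traceExp q x (fun s => f s.length) = binExp (1 - q) x.length f := by
  induction x generalizing f with
  | nil => rfl
  | cons b x ih =>
    simp only [traceExp_cons, List.length_cons, binExp_succ]
    rw [ih, ih (fun i => f (i + 1))]
    ring

lemma binWeight_of_lt {n i : ℕ} (h : n < i) : binWeight θ n i = 0 := by
  simp [binWeight, Nat.choose_eq_zero_of_lt h]

lemma binWeight_succ_zero (n : ℕ) : binWeight θ (n + 1) 0 = (1 - θ) * binWeight θ n 0 := by
  simp [binWeight, pow_succ']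

lemma binWeight_succ_succ (n i : ℕ) :
    binWeight θ (n + 1) (i + 1) = θ * binWeight θ n i + (1 - θ) * binWeight θ n (i + 1) := by
  rcases lt_or_ge i n with h | h
  · obtain ⟨k, rfl⟩ := Nat.exists_eq_add_of_lt h
    simp only [binWeight, Nat.choose_succ_succ, show i + k + 1 + 1 - (i + 1) = k + 1 by omega,
      show i + k + 1 - i = k + 1 by omega, show i + k + 1 - (i + 1) = k by omega]
    push_cast
    ring
  · rw [binWeight_of_lt (show n < i + 1 by omega)]
    simp only [binWeight, Nat.choose_succ_succ, Nat.choose_eq_zero_of_lt (show n < i + 1 by omega),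
      Nat.add_sub_add_right]
    push_cast
    ring

lemma binWeight_nonneg (h0 : 0 ≤ θ) (h1 : θ ≤ 1) (n i : ℕ) : 0 ≤ binWeight θ n i := by
  have : 0 ≤ 1 - θ := by linarith
  rw [binWeight]; positivity

lemma binExp_eq_sum_of_lt {n N : ℕ} (h : n < N) (f : ℕ → ℝ) :
    binExp θ n f = ∑ i ∈ Finset.range N, binWeight θ n i * f i := by
  induction n generalizing N f with
  | zero =>
    rw [Finset.sum_eq_single 0]
    · simp [binWeight]
    · intro i _ hi
      rw [binWeight_of_lt (Nat.pos_of_ne_zero hi), zero_mul]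
    · simp; omega
  | succ n ih =>
    obtain ⟨N, rfl⟩ : ∃ M, N = M + 1 := ⟨N - 1, by omega⟩
    rw [binExp_succ, ih (N := N + 1) (by omega), ih (N := N) (by omega), Finset.sum_range_succ',
      Finset.sum_range_succ' _ N, binWeight_succ_zero]
    simp only [binWeight_succ_succ, add_mul, Finset.sum_add_distrib, mul_add, mul_assoc,
      Finset.mul_sum]
    ring

lemma succ_mul_binWeight (n i : ℕ) :
    (n + 1 : ℝ) * (1 - θ) * binWeight θ n i = (n + 1 - i) * binWeight θ (n + 1) i := by
  rcases lt_trichotomy i (n + 1) with h | h | h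
  · have h1 := Nat.choose_mul_succ_eq n i
    have h2 : (n.choose i : ℝ) * (n + 1) = (n + 1).choose i * (n + 1 - i) := by
      have : ((n + 1 - i : ℕ) : ℝ) = n + 1 - i := by rw [Nat.cast_sub h.le]; push_cast; ring
      rw [← this]; exact_mod_cast h1
    rw [binWeight, binWeight, show n + 1 - i = n - i + 1 by omega, pow_succ]
    linear_combination (1 - θ) * θ ^ i * (1 - θ) ^ (n - i) * h2
  · rw [binWeight_of_lt (by omega), h]; push_cast; ring
  · rw [binWeight_of_lt (by omega), binWeight_of_lt (by omega)]; ring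

/-- The increments of the binomial weights in terms of the weights of the next row. -/
lemma binWeight_sub_succ (n i : ℕ) :
    (n + 1 : ℝ) * θ * (1 - θ) * (binWeight θ n i - binWeight θ n (i + 1)) =
      ((i + 1 : ℕ) - (n + 1) * θ) * binWeight θ (n + 1) (i + 1) := by
  have h1 := succ_mul_binWeight (θ := θ) n (i + 1)
  have h2 := binWeight_succ_succ (θ := θ) n i
  push_cast at h1 ⊢
  linear_combination (-1 : ℝ) * h1 - (n + 1 : ℝ) * (1 - θ) * h2

/-- By `succ_mul_binWeight`, passing from row `n + 1` to row `n` multiplies by a factor affine in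
the index, so the antisymmetrisation leaves only `i - j`. -/
lemma binWeight_commutator (n i j : ℕ) :
    (n + 1 : ℝ) * (1 - θ) *
      (binWeight θ (n + 1) i * binWeight θ n j - binWeight θ n i * binWeight θ (n + 1) j) =
      (i - j) * (binWeight θ (n + 1) i * binWeight θ (n + 1) j) := by
  have h1 := succ_mul_binWeight (θ := θ) n i
  have h2 := succ_mul_binWeight (θ := θ) n j
  linear_combination binWeight θ (n + 1) i * h2 - binWeight θ (n + 1) j * h1

lemma binExp_central_one (n : ℕ) : binExp θ n (fun i => (i : ℝ) - n * θ) = 0 := by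
  induction n with
  | zero => simp
  | succ n ih =>
    have h1 : (fun i : ℕ => (i : ℝ) - (n + 1 : ℕ) * θ) = fun i : ℕ => ((i : ℝ) - n * θ) - θ := by
      funext i; push_cast; ring
    have h2 : (fun i : ℕ => ((i + 1 : ℕ) : ℝ) - (n + 1 : ℕ) * θ) =
        fun i : ℕ => ((i : ℝ) - n * θ) - (θ - 1) := by
      funext i; push_cast; ring
    rw [binExp_succ, h2, h1, binExp_sub n (fun i : ℕ => (i : ℝ) - n * θ) (fun _ => θ),
      binExp_sub n (fun i : ℕ => (i : ℝ) - n * θ), binExp_const, binExp_const, ih]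
    ring

lemma binExp_central_sq (n : ℕ) :
    binExp θ n (fun i => ((i : ℝ) - n * θ) ^ 2) = n * (θ * (1 - θ)) := by
  induction n with
  | zero => simp
  | succ n ih =>
    have h1 : (fun i : ℕ => ((i : ℝ) - (n + 1 : ℕ) * θ) ^ 2) =
        fun i : ℕ => (((i : ℝ) - n * θ) ^ 2 + (-2 * θ) * ((i : ℝ) - n * θ)) + θ ^ 2 := by
      funext i; push_cast; ring
    have h2 : (fun i : ℕ => (((i + 1 : ℕ) : ℝ) - (n + 1 : ℕ) * θ) ^ 2) =
        fun i : ℕ => (((i : ℝ) - n * θ) ^ 2 + (2 * (1 - θ)) * ((i : ℝ) - n * θ)) +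
          (1 - θ) ^ 2 := by
      funext i; push_cast; ring
    rw [binExp_succ, h2, h1]
    simp only [binExp_add, binExp_mul, binExp_const, ih, binExp_central_one]
    push_cast; ring

lemma binExp_central_four_le (h0 : 0 ≤ θ) (h1 : θ ≤ 1) (n : ℕ) :
    binExp θ n (fun i => ((i : ℝ) - n * θ) ^ 4) ≤ 3 * (n : ℝ) ^ 2 := by
  induction n with
  | zero => simp
  | succ n ih =>
    have e1 : (fun i : ℕ => ((i : ℝ) - (n + 1 : ℕ) * θ) ^ 4) =
        fun i : ℕ => (((i : ℝ) - n * θ) ^ 4 + (-4 * θ) * ((i : ℝ) - n * θ) ^ 3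
          + (6 * θ ^ 2) * ((i : ℝ) - n * θ) ^ 2 + (-4 * θ ^ 3) * ((i : ℝ) - n * θ)) + θ ^ 4 := by
      funext i; push_cast; ring
    have e2 : (fun i : ℕ => (((i + 1 : ℕ) : ℝ) - (n + 1 : ℕ) * θ) ^ 4) =
        fun i : ℕ => (((i : ℝ) - n * θ) ^ 4 + (4 * (1 - θ)) * ((i : ℝ) - n * θ) ^ 3
          + (6 * (1 - θ) ^ 2) * ((i : ℝ) - n * θ) ^ 2
          + (4 * (1 - θ) ^ 3) * ((i : ℝ) - n * θ)) + (1 - θ) ^ 4 := by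
      funext i; push_cast; ring
    rw [binExp_succ, e2, e1]
    simp only [binExp_add, binExp_mul, binExp_const, binExp_central_sq, binExp_central_one]
    set X := binExp θ n (fun i => ((i : ℝ) - n * θ) ^ 4)
    set Y := binExp θ n (fun i => ((i : ℝ) - n * θ) ^ 3)
    have hs0 : 0 ≤ θ * (1 - θ) := mul_nonneg h0 (by linarith)
    have hs1 : θ * (1 - θ) ≤ 1 / 4 := by nlinarith [sq_nonneg (θ - 1 / 2)]
    have hn : (0 : ℝ) ≤ n := n.cast_nonneg
    set σ := θ * (1 - θ) with hσ
    have : (1 - θ) * (X + -4 * θ * Y + 6 * θ ^ 2 * (n * σ) + -4 * θ ^ 3 * 0 + θ ^ 4) +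
        θ * (X + 4 * (1 - θ) * Y + 6 * (1 - θ) ^ 2 * (n * σ) + 4 * (1 - θ) ^ 3 * 0 +
          (1 - θ) ^ 4) = X + 6 * n * (σ * σ) + σ * (1 - 3 * σ) := by
      rw [hσ]; ring
    rw [this]
    have h2 : σ * σ ≤ 1 / 4 * (1 / 4) := mul_le_mul hs1 hs1 hs0 (by norm_num)
    have h3 : 6 * n * (σ * σ) ≤ 6 * n * (1 / 4 * (1 / 4)) := by gcongr
    push_cast
    nlinarith

/-- Binomial weights are `O(n ^ (-1/2))`. -/
lemma binWeight_le (h0 : 0 < θ) (h1 : θ < 1) (n i : ℕ) :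
    binWeight θ n i ≤ 1 / Real.sqrt ((n + 1) * (θ * (1 - θ))) := by
  set s : ℝ := (n + 1) * (θ * (1 - θ)) with hs
  have hsp : 0 < s := mul_pos (by positivity) (mul_pos h0 (by linarith))
  -- Telescoping to infinity: the increments are first central moment terms of row `n + 1`, whose
  -- variance is `s`. Hence the weight is at most `s⁻¹ * E|X - EX| ≤ s⁻¹ * √s`.
  have htel : binWeight θ n i =
      ∑ k ∈ Finset.range (n + 1), (binWeight θ n (i + k) - binWeight θ n (i + k + 1)) := by
    have := Finset.sum_range_sub' (fun k => binWeight θ n (i + k)) (n + 1)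
    simp only [← add_assoc] at this
    rw [this, binWeight_of_lt (i := i + n + 1) (by omega)]
    simp
  have hstep : ∀ k, binWeight θ n k - binWeight θ n (k + 1) ≤
      s⁻¹ * (|((k + 1 : ℕ) : ℝ) - (n + 1 : ℕ) * θ| * binWeight θ (n + 1) (k + 1)) := by
    intro k
    have h := binWeight_sub_succ (θ := θ) n k
    rw [le_inv_mul_iff₀ hsp]
    calc s * (binWeight θ n k - binWeight θ n (k + 1))
        = ((k + 1 : ℕ) - (n + 1) * θ) * binWeight θ (n + 1) (k + 1) := by rw [← h, hs]; ring
      _ ≤ _ := by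
        have := binWeight_nonneg h0.le h1.le (n + 1) (k + 1)
        gcongr
        push_cast
        exact le_abs_self _
  have hsum : ∑ k ∈ Finset.range (n + 1), (binWeight θ n (i + k) - binWeight θ n (i + k + 1)) ≤
      s⁻¹ * binExp θ (n + 1) (fun k => |(k : ℝ) - (n + 1 : ℕ) * θ|) := by
    rw [binExp_eq_sum_of_lt (N := i + n + 2) (by omega), Finset.mul_sum]
    calc _ ≤ ∑ k ∈ Finset.range (n + 1), s⁻¹ * (|((i + k + 1 : ℕ) : ℝ) - (n + 1 : ℕ) * θ| *
            binWeight θ (n + 1) (i + k + 1)) := Finset.sum_le_sum fun k _ => hstep _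
      _ = ∑ k ∈ (Finset.range (n + 1)).image (fun k => i + k + 1),
            s⁻¹ * (binWeight θ (n + 1) k * |(k : ℝ) - (n + 1 : ℕ) * θ|) := by
          rw [Finset.sum_image (fun a _ b _ h => by simpa using h)]
          refine Finset.sum_congr rfl fun k _ => ?_
          ring
      _ ≤ _ := by
          refine Finset.sum_le_sum_of_subset_of_nonneg ?_ fun k _ _ => ?_
          · intro k hk
            simp only [Finset.mem_image, Finset.mem_range] at hk ⊢
            omega
          · have := binWeight_nonneg h0.le h1.le (n + 1) k
            positivity
  have habs : binExp θ (n + 1) (fun k => |(k : ℝ) - (n + 1 : ℕ) * θ|) ≤ Real.sqrt s := by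
    have hr : 0 < Real.sqrt s := Real.sqrt_pos.2 hsp
    have : binExp θ (n + 1) (fun k => |(k : ℝ) - (n + 1 : ℕ) * θ|) ≤
        binExp θ (n + 1) (fun k => (2 * Real.sqrt s)⁻¹ * ((k : ℝ) - (n + 1 : ℕ) * θ) ^ 2 +
          Real.sqrt s / 2) := by
      refine binExp_mono h0.le h1.le _ fun k => ?_
      rw [← sq_abs, ← sub_nonneg]
      have : (2 * Real.sqrt s)⁻¹ * |(k : ℝ) - (n + 1 : ℕ) * θ| ^ 2 + Real.sqrt s / 2 -
          |(k : ℝ) - (n + 1 : ℕ) * θ| =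
          (2 * Real.sqrt s)⁻¹ * (|(k : ℝ) - (n + 1 : ℕ) * θ| - Real.sqrt s) ^ 2 := by
        field_simp; ring
      rw [this]; positivity
    rw [binExp_add, binExp_mul, binExp_const, binExp_central_sq] at this
    refine this.trans (le_of_eq ?_)
    have e : ((n + 1 : ℕ) : ℝ) * (θ * (1 - θ)) = Real.sqrt s * Real.sqrt s := by
      rw [Real.mul_self_sqrt hsp.le, hs]; push_cast; ring
    rw [e]
    field_simp; ring
  calc binWeight θ n i ≤ s⁻¹ * Real.sqrt s := by
        rw [htel]; exact hsum.trans (by gcongr)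
    _ = 1 / Real.sqrt s := by
        have hr : 0 < Real.sqrt s := Real.sqrt_pos.2 hsp
        rw [eq_div_iff hr.ne', mul_assoc, Real.mul_self_sqrt hsp.le, inv_mul_cancel₀ hsp.ne']

/-- Comparison with the integral of the Cauchy kernel, an arctangent. As `1 ≤ a`, the kernel varies
by at most a factor 4 over a unit step. -/
lemma sum_inv_add_sq_le {a : ℝ} (ha : 1 ≤ a) (c : ℝ) (N : ℕ) :
    ∑ k ∈ Finset.range N, 1 / (a ^ 2 + ((k : ℝ) - c) ^ 2) ≤ 4 * Real.pi / a := by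
  have ha0 : 0 < a := by linarith
  have hstep : ∀ x : ℝ, 1 / (a ^ 2 + x ^ 2) ≤
      4 / a * (Real.arctan ((x + 1) / a) - Real.arctan (x / a)) := by
    intro x
    obtain ⟨ξ, hξ, h⟩ := exists_deriv_eq_slope Real.arctan
      (show x / a < (x + 1) / a by gcongr; linarith) Real.continuous_arctan.continuousOn
      Real.differentiable_arctan.differentiableOn
    have hd : (x + 1) / a - x / a = 1 / a := by ring
    rw [Real.deriv_arctan, hd, div_div_eq_mul_div, div_one] at h
    have h' : Real.arctan ((x + 1) / a) - Real.arctan (x / a) = 1 / (1 + ξ ^ 2) / a := by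
      rw [show 1 / (1 + ξ ^ 2) = _ from h]; field_simp
    rw [h', show 4 / a * (1 / (1 + ξ ^ 2) / a) = 4 / (a ^ 2 + (a * ξ) ^ 2) by field_simp,
      div_le_div_iff₀ (by positivity) (by positivity)]
    obtain ⟨l, r⟩ := hξ
    rw [div_lt_iff₀ ha0] at l
    rw [lt_div_iff₀ ha0] at r
    nlinarith [sq_nonneg x, sq_nonneg (x - 1), sq_nonneg (x + 1)]
  calc _ ≤ ∑ k ∈ Finset.range N, 4 / a * (Real.arctan (((k + 1 : ℕ) - c) / a) -
        Real.arctan ((k - c) / a)) := by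
        refine Finset.sum_le_sum fun k _ => (hstep _).trans (le_of_eq ?_)
        push_cast; ring_nf
    _ = 4 / a * (Real.arctan ((N - c) / a) - Real.arctan (((0 : ℕ) - c) / a)) := by
        rw [← Finset.mul_sum, Finset.sum_range_sub (fun k : ℕ => Real.arctan ((k - c) / a))]
    _ ≤ 4 / a * (Real.pi / 2 - -(Real.pi / 2)) := by
        gcongr
        · exact (Real.arctan_lt_pi_div_two _).le
        · exact (Real.neg_pi_div_two_lt_arctan _).le
    _ = 4 * Real.pi / a := by ring

end TraceReconstruction

/-! ### Markov words and martingale sums. -/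

namespace TraceReconstruction

section words

variable {α : Type*} [Fintype α]

/-- The expectation of `f` over the words of length `L` of the Markov chain with transition
weights `ν` started from (but not including) `c`. -/
noncomputable def wordExp (ν : α → α → ℝ) : ℕ → α → (List α → ℝ) →ₗ[ℝ] ℝ
  | 0, _ => LinearMap.proj []
  | L + 1, c => ∑ d, ν c d • (wordExp ν L d ∘ₗ LinearMap.funLeft ℝ ℝ (List.cons d))

/-- The sum of the two-letter statistic `ψ` along a word preceded by the letter `c`, with the
position-dependent coefficients `g`. -/
def patSum (ψ : α → α → ℝ) : (ℕ → ℝ) → α → List α → ℝ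
  | _, _, [] => 0
  | g, c, d :: w => g 0 * ψ c d + patSum ψ (fun i => g (i + 1)) d w

variable {ν : α → α → ℝ}

@[simp] lemma wordExp_zero (c : α) (f : List α → ℝ) : wordExp ν 0 c f = f [] := rfl

lemma wordExp_succ (L : ℕ) (c : α) (f : List α → ℝ) :
    wordExp ν (L + 1) c f = ∑ d, ν c d * wordExp ν L d (fun w => f (d :: w)) := by
  simp only [wordExp, LinearMap.sum_apply]
  rfl

lemma wordExp_add (L : ℕ) (c : α) (f g : List α → ℝ) :
    wordExp ν L c (fun w => f w + g w) = wordExp ν L c f + wordExp ν L c g := map_add _ f g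

lemma wordExp_sub (L : ℕ) (c : α) (f g : List α → ℝ) :
    wordExp ν L c (fun w => f w - g w) = wordExp ν L c f - wordExp ν L c g := map_sub _ f g

lemma wordExp_mul (L : ℕ) (c : α) (r : ℝ) (f : List α → ℝ) :
    wordExp ν L c (fun w => r * f w) = r * wordExp ν L c f := map_smul _ r f

lemma wordExp_sum {ι : Type*} (s : Finset ι) (L : ℕ) (c : α) (f : ι → List α → ℝ) :
    wordExp ν L c (fun w => ∑ i ∈ s, f i w) = ∑ i ∈ s, wordExp ν L c (f i) := by
  rw [← map_sum]
  congr 1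
  funext w
  simp

lemma wordExp_const (h1 : ∀ c, ∑ d, ν c d = 1) (L : ℕ) (c : α) (r : ℝ) :
    wordExp ν L c (fun _ => r) = r := by
  induction L generalizing c with
  | zero => rfl
  | succ L ih => simp only [wordExp_succ, ih, ← Finset.sum_mul, h1, one_mul]

lemma wordExp_mono (h0 : ∀ c d, 0 ≤ ν c d) (L : ℕ) (c : α) {f g : List α → ℝ}
    (h : ∀ w, f w ≤ g w) : wordExp ν L c f ≤ wordExp ν L c g := by
  induction L generalizing c f g with
  | zero => exact h _
  | succ L ih =>
    rw [wordExp_succ, wordExp_succ]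
    refine Finset.sum_le_sum fun d _ => mul_le_mul_of_nonneg_left (ih d fun w => h _) (h0 c d)

lemma wordExp_nonneg (h0 : ∀ c d, 0 ≤ ν c d) (L : ℕ) (c : α) {f : List α → ℝ}
    (h : ∀ w, 0 ≤ f w) : 0 ≤ wordExp ν L c f := by
  have := wordExp_mono h0 L c h
  rwa [show (fun _ : List α => (0 : ℝ)) = 0 from rfl, map_zero] at this

/-- Second moment of a martingale sum. -/
lemma wordExp_patSum_sq_le (h0 : ∀ c d, 0 ≤ ν c d) (h1 : ∀ c, ∑ d, ν c d = 1)
    {ψ : α → α → ℝ} (hψ : ∀ c, ∑ d, ν c d * ψ c d = 0) {B : ℝ}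
    (hB : ∀ c, ∑ d, ν c d * ψ c d ^ 2 ≤ B) (L : ℕ) (c : α) (g : ℕ → ℝ) (x : ℝ) :
    wordExp ν L c (fun w => (x + patSum ψ g c w) ^ 2) ≤
      x ^ 2 + B * ∑ i ∈ Finset.range L, g i ^ 2 := by
  induction L generalizing c g x with
  | zero => simp [patSum]
  | succ L ih =>
    rw [wordExp_succ, Finset.sum_range_succ']
    set V := ∑ i ∈ Finset.range L, g (i + 1) ^ 2
    calc _ ≤ ∑ d, ν c d * ((x + g 0 * ψ c d) ^ 2 + B * V) := by
          refine Finset.sum_le_sum fun d _ => mul_le_mul_of_nonneg_left ?_ (h0 c d)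
          simp only [patSum, ← add_assoc]
          exact ih d _ _
      _ = (x ^ 2 + B * V) * ∑ d, ν c d + 2 * x * g 0 * ∑ d, ν c d * ψ c d +
            g 0 ^ 2 * ∑ d, ν c d * ψ c d ^ 2 := by
          simp only [Finset.mul_sum, ← Finset.sum_add_distrib]
          refine Finset.sum_congr rfl fun d _ => ?_
          ring
      _ ≤ (x ^ 2 + B * V) * 1 + 2 * x * g 0 * 0 + g 0 ^ 2 * B := by
          rw [h1, hψ]
          gcongr
          exact hB c
      _ = _ := by ring

/-- Cauchy–Schwarz, in the form of a nonnegative variance, together with orthogonality of martingale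
increments. -/
lemma abs_wordExp_mul_patSum_le (h0 : ∀ c d, 0 ≤ ν c d) (h1 : ∀ c, ∑ d, ν c d = 1)
    {ψ : α → α → ℝ} (hψ : ∀ c, ∑ d, ν c d * ψ c d = 0) {B : ℝ}
    (hB : ∀ c, ∑ d, ν c d * ψ c d ^ 2 ≤ B) (L : ℕ) (c : α) (g : ℕ → ℝ) {f : List α → ℝ}
    (hf : ∀ w, |f w| ≤ 1) :
    |wordExp ν L c (fun w => f w * patSum ψ g c w)| ≤
      Real.sqrt (B * ∑ i ∈ Finset.range L, g i ^ 2) := by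
  refine Real.abs_le_sqrt ?_
  set m := wordExp ν L c (fun w => f w * patSum ψ g c w) with hm
  have hvar : 0 ≤ wordExp ν L c (fun w => (f w * patSum ψ g c w - m) ^ 2) :=
    wordExp_nonneg h0 L c fun w => sq_nonneg _
  have he : (fun w => (f w * patSum ψ g c w - m) ^ 2) =
      fun w => ((f w * patSum ψ g c w) ^ 2 - 2 * m * (f w * patSum ψ g c w)) + m ^ 2 := by
    funext w; ring
  rw [he, wordExp_add, wordExp_sub, wordExp_mul, wordExp_const h1, ← hm] at hvar
  have hle : wordExp ν L c (fun w => (f w * patSum ψ g c w) ^ 2) ≤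
      wordExp ν L c (fun w => (0 + patSum ψ g c w) ^ 2) := by
    refine wordExp_mono h0 L c fun w => ?_
    rw [mul_pow, zero_add]
    have : f w ^ 2 ≤ 1 := (sq_le_one_iff_abs_le_one _).2 (hf w)
    nlinarith [sq_nonneg (patSum ψ g c w)]
  have := wordExp_patSum_sq_le h0 h1 hψ hB L c g 0
  nlinarith

/-- Splitting the word at each position turns a density `patSum` into a sum over marked positions;
this is how insertions become martingales. -/
lemma wordExp_mul_patSum (ψ : α → α → ℝ) (L : ℕ) (c : α) (g : ℕ → ℝ) (f : List α → ℝ) :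
    wordExp ν L c (fun w => f w * patSum ψ g c w) = ∑ i ∈ Finset.range L, g i *
      wordExp ν i c (fun u => ∑ d, ν (u.getLastD c) d * ψ (u.getLastD c) d *
        wordExp ν (L - 1 - i) d (fun v => f (u ++ d :: v))) := by
  induction L generalizing c g f with
  | zero => simp [patSum]
  | succ L ih =>
    rw [wordExp_succ, Finset.sum_range_succ']
    have h : ∀ d, wordExp ν L d (fun w => f (d :: w) * patSum ψ g c (d :: w)) =
        g 0 * ψ c d * wordExp ν L d (fun w => f (d :: w)) +
          wordExp ν L d (fun w => f (d :: w) * patSum ψ (fun i => g (i + 1)) d w) := by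
      intro d
      rw [← wordExp_mul, ← wordExp_add]
      congr 1
      funext w
      rw [patSum]; ring
    simp only [h, mul_add, Finset.sum_add_distrib]
    rw [add_comm]
    congr 1
    · simp only [ih, Finset.mul_sum]
      rw [Finset.sum_comm]
      refine Finset.sum_congr rfl fun i hi => ?_
      have : L + 1 - 1 - (i + 1) = L - 1 - i := by omega
      rw [wordExp_succ, Finset.mul_sum]
      refine Finset.sum_congr rfl fun d _ => ?_
      simp only [List.getLastD_cons, this, List.cons_append]
      ring
    · simp only [wordExp_zero, List.getLastD_nil, List.nil_append, Nat.add_sub_cancel, Nat.sub_zero,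
        Finset.mul_sum]
      refine Finset.sum_congr rfl fun d _ => ?_
      ring

end words

/-! ### Inserting marked letters in iid words. -/

section iid

variable {α : Type*} [Fintype α] {ω : α → ℝ}

lemma wordExp_iid_start (L : ℕ) (c c' : α) (f : List α → ℝ) :
    wordExp (fun _ => ω) L c f = wordExp (fun _ => ω) L c' f := by
  cases L with
  | zero => rfl
  | succ L => rw [wordExp_succ, wordExp_succ]

lemma wordExp_iid_add (i j : ℕ) (c : α) (f : List α → ℝ) :
    wordExp (fun _ => ω) (i + j) c f =
      wordExp (fun _ => ω) i c (fun u => wordExp (fun _ => ω) j c (fun v => f (u ++ v))) := by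
  induction i generalizing c f with
  | zero => simp
  | succ i ih =>
    rw [Nat.add_right_comm, wordExp_succ, wordExp_succ]
    refine Finset.sum_congr rfl fun d _ => ?_
    rw [ih]
    simp only [List.cons_append, wordExp_iid_start j d c]

lemma wordExp_iid_succ' (i : ℕ) (c : α) (f : List α → ℝ) :
    wordExp (fun _ => ω) (i + 1) c f =
      wordExp (fun _ => ω) i c (fun u => ∑ d, ω d * f (u ++ [d])) := by
  rw [wordExp_iid_add]
  simp only [wordExp_succ, wordExp_zero]

variable [DecidableEq α]

/-- Marking one letter `d` with coefficients of zero sum. -/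
lemma abs_sum_mark_letter_le (h0 : ∀ d, 0 ≤ ω d) (h1 : ∑ d, ω d = 1) (d : α) (hd : 0 < ω d)
    (c : α) (L : ℕ) (g : ℕ → ℝ) (hg : ∑ i ∈ Finset.range L, g i = 0) {f : List α → ℝ}
    (hf : ∀ w, |f w| ≤ 1) :
    |∑ i ∈ Finset.range L, g i * wordExp (fun _ => ω) i c (fun u =>
      wordExp (fun _ => ω) (L - 1 - i) c (fun v => f (u ++ d :: v)))| ≤
      Real.sqrt ((ω d)⁻¹ * ∑ i ∈ Finset.range L, g i ^ 2) := by
  -- Weighting by `1 + ψ` forces the letter `d` at the position. The term from the constant 1 is the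
  -- same for every position and vanishes by `hg`.
  set ψ : α → α → ℝ := fun _ e => (if e = d then (ω d)⁻¹ else 0) - 1 with hψ
  have hid := wordExp_mul_patSum (ν := fun _ => ω) ψ L c g f
  have hsimp : ∀ i ∈ Finset.range L, g i * wordExp (fun _ => ω) i c (fun u =>
      ∑ e, ω e * ψ (u.getLastD c) e *
        wordExp (fun _ => ω) (L - 1 - i) e (fun v => f (u ++ e :: v))) =
      g i * wordExp (fun _ => ω) i c (fun u =>
        wordExp (fun _ => ω) (L - 1 - i) c (fun v => f (u ++ d :: v))) -
      g i * wordExp (fun _ => ω) L c f := by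
    intro i hi
    have hL : L = i + (L - 1 - i + 1) := by have := Finset.mem_range.1 hi; omega
    have hW : wordExp (fun _ => ω) L c f = wordExp (fun _ => ω) i c (fun u =>
        ∑ e, ω e * wordExp (fun _ => ω) (L - 1 - i) e (fun v => f (u ++ e :: v))) := by
      conv_lhs => rw [hL, wordExp_iid_add]
      simp only [wordExp_succ]
    rw [← mul_sub, hW, ← wordExp_sub]
    congr 2
    funext u
    simp only [hψ, mul_sub, sub_mul, Finset.sum_sub_distrib, mul_one, mul_ite, ite_mul, mul_zero,
      zero_mul, Finset.sum_ite_eq', Finset.mem_univ, if_true, mul_inv_cancel₀ hd.ne', one_mul]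
    rw [wordExp_iid_start _ d c]
  rw [Finset.sum_congr rfl hsimp, Finset.sum_sub_distrib, ← Finset.sum_mul, hg, zero_mul,
    sub_zero] at hid
  rw [← hid]
  refine abs_wordExp_mul_patSum_le (fun _ => h0) (fun _ => h1) ?_ ?_ L c g hf
  · intro _
    simp [hψ, mul_sub, Finset.sum_sub_distrib, h1, mul_inv_cancel₀ hd.ne']
  · intro _
    have : ∀ e, ω e * ψ c e ^ 2 =
        (if e = d then ω e * ((ω d)⁻¹ ^ 2 - 2 * (ω d)⁻¹) else 0) + ω e := by
      intro e
      simp only [hψ]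
      split_ifs <;> ring
    change ∑ e, ω e * ψ c e ^ 2 ≤ _
    simp only [this, Finset.sum_add_distrib, h1, Finset.sum_ite_eq', Finset.mem_univ, if_true]
    have : ω d * ((ω d)⁻¹ ^ 2 - 2 * (ω d)⁻¹) + 1 = (ω d)⁻¹ - 1 := by field_simp; ring
    rw [this]; linarith

/-- Marking two consecutive letters `b`, `a`, in comparison with marking only `b`. -/
lemma abs_sum_mark_pair_sub_le (h0 : ∀ d, 0 ≤ ω d) (h1 : ∑ d, ω d = 1) (a b c : α)
    (ha : 0 < ω a) (hb : 0 < ω b) (L : ℕ) (g : ℕ → ℝ) {f : List α → ℝ}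
    (hf : ∀ w, |f w| ≤ 1) :
    |∑ i ∈ Finset.range L, g i * (wordExp (fun _ => ω) i c (fun u =>
        wordExp (fun _ => ω) (L - 1 - i) c (fun v => f (u ++ b :: a :: v))) -
      wordExp (fun _ => ω) i c (fun u =>
        wordExp (fun _ => ω) (L - i) c (fun v => f (u ++ b :: v))))| ≤
      Real.sqrt ((ω b)⁻¹ ^ 2 * (ω a)⁻¹ * ∑ i ∈ Finset.range L, g i ^ 2) := by
  set ψ : α → α → ℝ := fun e e' =>
    (if e = b then (ω b)⁻¹ else 0) * ((if e' = a then (ω a)⁻¹ else 0) - 1) with hψ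
  -- The statistic is read at the second letter of the pair, hence the shift by one. At index 0 it
  -- would involve the fictitious starting letter, so it gets coefficient 0.
  set γ : ℕ → ℝ := fun i => if i = 0 then 0 else g (i - 1) with hγ
  have hid := wordExp_mul_patSum (ν := fun _ => ω) ψ (L + 1) c γ f
  have hsimp : ∀ i ∈ Finset.range L, γ (i + 1) * wordExp (fun _ => ω) (i + 1) c (fun u =>
      ∑ e, ω e * ψ (u.getLastD c) e *
        wordExp (fun _ => ω) (L + 1 - 1 - (i + 1)) e (fun v => f (u ++ e :: v))) =
      g i * (wordExp (fun _ => ω) i c (fun u =>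
        wordExp (fun _ => ω) (L - 1 - i) c (fun v => f (u ++ b :: a :: v))) -
      wordExp (fun _ => ω) i c (fun u =>
        wordExp (fun _ => ω) (L - i) c (fun v => f (u ++ b :: v)))) := by
    intro i hi
    have hL : L - i = L - 1 - i + 1 := by have := Finset.mem_range.1 hi; omega
    have hL' : L + 1 - 1 - (i + 1) = L - 1 - i := by omega
    rw [wordExp_iid_succ', hL', hL, ← wordExp_sub]
    congr 2
    funext u
    simp only [hψ, List.getLastD_concat, mul_sub, sub_mul, Finset.sum_sub_distrib, mul_one,
      mul_ite, ite_mul, mul_zero, zero_mul, Finset.sum_ite_eq', Finset.mem_univ, if_true,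
      Finset.sum_const_zero, Finset.sum_ite_irrel, List.append_assoc, List.cons_append,
      List.nil_append]
    rw [wordExp_succ, wordExp_iid_start _ a c]
    simp only [Finset.mul_sum]
    congr 1
    · field_simp
    · refine Finset.sum_congr rfl fun e _ => ?_
      field_simp
  rw [Finset.sum_range_succ', Finset.sum_congr rfl hsimp] at hid
  simp only [hγ, if_true, zero_mul, add_zero] at hid
  rw [← hid]
  have hsq : ∑ i ∈ Finset.range L, g i ^ 2 = ∑ i ∈ Finset.range (L + 1), γ i ^ 2 := by
    rw [Finset.sum_range_succ']
    simp [hγ]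
  rw [hsq]
  refine abs_wordExp_mul_patSum_le (fun _ => h0) (fun _ => h1) ?_ ?_ (L + 1) c γ hf
  · intro e
    have : ∀ e', ω e' * ψ e e' = (if e = b then (ω b)⁻¹ else 0) *
        ((if e' = a then ω e' * (ω a)⁻¹ else 0) - ω e') := by
      intro e'
      simp only [hψ]
      split_ifs <;> ring
    change ∑ e', ω e' * ψ e e' = 0
    simp only [this, ← Finset.mul_sum, Finset.sum_sub_distrib, h1, Finset.sum_ite_eq',
      Finset.mem_univ, if_true, mul_inv_cancel₀ ha.ne', sub_self, mul_zero]
  · intro e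
    have : ∀ e', ω e' * ψ e e' ^ 2 = (if e = b then (ω b)⁻¹ else 0) ^ 2 *
        ((if e' = a then ω e' * ((ω a)⁻¹ ^ 2 - 2 * (ω a)⁻¹) else 0) + ω e') := by
      intro e'
      simp only [hψ]
      split_ifs <;> ring
    change ∑ e', ω e' * ψ e e' ^ 2 ≤ _
    simp only [this, ← Finset.mul_sum, Finset.sum_add_distrib, h1, Finset.sum_ite_eq',
      Finset.mem_univ, if_true]
    have h2 : ω a * ((ω a)⁻¹ ^ 2 - 2 * (ω a)⁻¹) + 1 = (ω a)⁻¹ - 1 := by field_simp; ring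
    have h3 : 1 ≤ (ω a)⁻¹ := by
      refine (one_le_inv₀ ha).2 ?_
      rw [← h1]
      exact Finset.single_le_sum (fun d _ => h0 d) (Finset.mem_univ a)
    rw [h2]
    split_ifs
    · gcongr; linarith
    · rw [zero_pow two_ne_zero, zero_mul]; positivity

end iid

end TraceReconstruction

/-! ### Block decomposition and the ℓ² bound for the defect. -/

namespace TraceReconstruction

/-- The law of the trace of `01`, conditioned on being nonempty: `some b` stands for the trace `b`
and `none` for the trace `01`. -/
noncomputable def blockWeight (q : ℝ) : Option Bool → ℝ
  | none => (1 - q) / (1 + q)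
  | some _ => q / (1 + q)

/-- The bit string of a sequence of blocks. -/
def blockFlatten : List (Option Bool) → List Bool
  | [] => []
  | none :: w => false :: true :: blockFlatten w
  | some b :: w => b :: blockFlatten w

lemma blockFlatten_append (u v : List (Option Bool)) :
    blockFlatten (u ++ v) = blockFlatten u ++ blockFlatten v := by
  induction u with
  | nil => rfl
  | cons a u ih => cases a <;> simp [blockFlatten, ih]

variable {q : ℝ}

lemma blockWeight_pos (h0 : 0 < q) (h1 : q < 1) (d : Option Bool) : 0 < blockWeight q d := by
  have : 0 < 1 - q := by linarith
  cases d <;> simp only [blockWeight] <;> positivity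

lemma sum_blockWeight (h0 : 0 < q) : ∑ d, blockWeight q d = 1 := by
  rw [Fintype.sum_option, Fintype.sum_bool]
  simp only [blockWeight]
  field_simp
  ring

/-- The trace of `(01)^n` is a binomial number of independent blocks. -/
lemma traceExp_zeroOnePow (h0 : 0 < q) (n : ℕ) (f : List Bool → ℝ) :
    traceExp q (zeroOnePow n) f = binExp (1 - q ^ 2) n (fun j =>
      wordExp (fun _ => blockWeight q) j none (fun w => f (blockFlatten w))) := by
  induction n generalizing f with
  | zero => rfl
  | succ n ih =>
    have hstep : (fun j => wordExp (fun _ => blockWeight q) (j + 1) none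
        (fun w => f (blockFlatten w))) = fun j =>
        (1 - q) / (1 + q) * wordExp (fun _ => blockWeight q) j none
          (fun w => f (false :: true :: blockFlatten w)) +
        (q / (1 + q) * wordExp (fun _ => blockWeight q) j none
          (fun w => f (true :: blockFlatten w)) +
        q / (1 + q) * wordExp (fun _ => blockWeight q) j none
          (fun w => f (false :: blockFlatten w))) := by
      funext j
      rw [wordExp_succ, Fintype.sum_option, Fintype.sum_bool]
      simp only [blockFlatten, blockWeight, wordExp_iid_start j _ none]
    rw [zeroOnePow_succ, traceExp_append, binExp_succ, hstep, binExp_add, binExp_add, binExp_mul,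
      binExp_mul, binExp_mul, ← ih, ← ih (fun s => f (false :: true :: s)),
      ← ih (fun s => f (true :: s)), ← ih (fun s => f (false :: s))]
    simp only [traceExp_cons, traceExp_nil, List.nil_append, List.cons_append]
    field_simp
    ring

/-- A pair of independent block sequences of lengths `i` and `j`, with `01` minus `10` inserted
between them. -/
noncomputable def defectExp (q : ℝ) (f : List Bool → ℝ) (i j : ℕ) : ℝ :=
  wordExp (fun _ => blockWeight q) i none (fun u =>
    wordExp (fun _ => blockWeight q) j none (fun v =>
      f (blockFlatten u ++ false :: true :: blockFlatten v) -
        f (blockFlatten u ++ true :: false :: blockFlatten v)))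

/-- Inserting `01` inserts the block `none`. Inserting `10` inserts the blocks `1` and `0`: forcing
the second after the first is a martingale increment by itself, and forcing the first alone uses the
zero sum. -/
lemma exists_abs_sum_defectExp_le (h0 : 0 < q) (h1 : q < 1) :
    ∃ K : ℝ, 0 < K ∧ ∀ (f : List Bool → ℝ), (∀ s, |f s| ≤ 1) → ∀ (L : ℕ) (g : ℕ → ℝ),
      ∑ i ∈ Finset.range (L + 1), g i = 0 →
      |∑ i ∈ Finset.range (L + 1), g i * defectExp q f i (L - i)| ≤
        K * Real.sqrt (∑ i ∈ Finset.range (L + 1), g i ^ 2) := by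
  set ω := blockWeight q
  have hω0 : ∀ d, 0 ≤ ω d := fun d => (blockWeight_pos h0 h1 d).le
  have hω1 : ∑ d, ω d = 1 := sum_blockWeight h0
  have hpos := blockWeight_pos h0 h1
  refine ⟨Real.sqrt (ω none)⁻¹ + Real.sqrt (ω (some true))⁻¹ +
    Real.sqrt ((ω (some true))⁻¹ ^ 2 * (ω (some false))⁻¹),
    by have := Real.sqrt_pos.2 (inv_pos.2 (hpos none)); positivity, fun f hf L g hg => ?_⟩
  -- With `10` inserted the word has `L + 2` blocks, one more than with `01`, so the coefficients
  -- are padded by one zero.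
  set h : ℕ → ℝ := fun i => if i < L + 1 then g i else 0 with hh
  have hgh : ∀ i ∈ Finset.range (L + 1), h i = g i := fun i hi =>
    if_pos (Finset.mem_range.1 hi)
  have hh0 : ∑ i ∈ Finset.range (L + 1 + 1), h i = 0 := by
    rw [Finset.sum_range_succ, Finset.sum_congr rfl hgh, hg]
    simp [hh]
  have hh2 : ∑ i ∈ Finset.range (L + 1 + 1), h i ^ 2 = ∑ i ∈ Finset.range (L + 1), g i ^ 2 := by
    rw [Finset.sum_range_succ, Finset.sum_congr rfl fun i hi => by rw [hgh i hi]]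
    simp [hh]
  have hF : ∀ w, |f (blockFlatten w)| ≤ 1 := fun w => hf _
  have b1 := abs_sum_mark_letter_le hω0 hω1 none (hpos none) none (L + 1) g hg hF
  have b2 := abs_sum_mark_letter_le hω0 hω1 (some true) (hpos _) none (L + 1 + 1) h hh0 hF
  have b3 := abs_sum_mark_pair_sub_le hω0 hω1 (some false) (some true) none (hpos _) (hpos _)
    (L + 1) g hF
  rw [Finset.sum_range_succ, Finset.sum_congr rfl fun i hi => by rw [hgh i hi]] at b2
  have hlast : h (L + 1) = 0 := by simp [hh]
  rw [hlast, zero_mul, add_zero, hh2] at b2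
  simp only [Nat.add_sub_cancel, blockFlatten_append, blockFlatten] at b1 b2 b3
  rw [Real.sqrt_mul (by have := hpos none; positivity)] at b1
  rw [Real.sqrt_mul (by have := hpos (some true); positivity)] at b2
  rw [Real.sqrt_mul (by have := hpos (some true); have := hpos (some false); positivity)] at b3
  simp only [mul_sub, Finset.sum_sub_distrib] at b3
  simp only [defectExp, wordExp_sub, mul_sub, Finset.sum_sub_distrib]
  rw [add_mul, add_mul]
  rw [abs_le] at b1 b2 b3 ⊢
  constructor <;> linarith [b1.1, b1.2, b2.1, b2.2, b3.1, b3.2]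

/-- Antidiagonals leave the square, which is harmless because `F` vanishes outside it. -/
lemma sum_range_mul_range_eq (N : ℕ) (F : ℕ → ℕ → ℝ)
    (hF : ∀ i j, N ≤ i ∨ N ≤ j → F i j = 0) :
    ∑ i ∈ Finset.range N, ∑ j ∈ Finset.range N, F i j =
      ∑ L ∈ Finset.range (2 * N), ∑ i ∈ Finset.range (L + 1), F i (L - i) := by
  rw [← Finset.sum_product', ← Finset.sum_fiberwise_of_maps_to
    (s := Finset.range N ×ˢ Finset.range N) (t := Finset.range (2 * N)) (g := fun p => p.1 + p.2)]
  · refine Finset.sum_congr rfl fun L _ => ?_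
    rw [← Finset.Nat.sum_antidiagonal_eq_sum_range_succ F]
    refine Finset.sum_subset ?_ ?_
    · intro p hp
      simpa using (Finset.mem_filter.1 hp).2
    · rintro ⟨i, j⟩ hp hn
      refine hF i j ?_
      by_contra! hc
      refine hn (Finset.mem_filter.2 ⟨?_, by simpa using hp⟩)
      simp [hc]
  · rintro ⟨i, j⟩ hp
    simp only [Finset.mem_product, Finset.mem_range] at hp ⊢
    omega

/-! ### Size of the coefficients and the upper bound. -/

/-- The antisymmetric coefficients of the difference of the two trace laws. -/
noncomputable def commCoeff (θ : ℝ) (n i j : ℕ) : ℝ :=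
  binWeight θ (n + 1) i * binWeight θ n j - binWeight θ n i * binWeight θ (n + 1) j

lemma commCoeff_eq_zero {θ : ℝ} {n i j : ℕ} (h : n + 2 ≤ i ∨ n + 2 ≤ j) :
    commCoeff θ n i j = 0 := by
  rcases h with h | h
  · rw [commCoeff, binWeight_of_lt (show n < i by omega), binWeight_of_lt (show n + 1 < i by omega)]
    ring
  · rw [commCoeff, binWeight_of_lt (show n < j by omega), binWeight_of_lt (show n + 1 < j by omega)]
    ring

lemma sum_commCoeff (θ : ℝ) (n L : ℕ) :
    ∑ i ∈ Finset.range (L + 1), commCoeff θ n i (L - i) = 0 := by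
  rw [← Finset.Nat.sum_antidiagonal_eq_sum_range_succ (commCoeff θ n)]
  have h := Finset.Nat.sum_antidiagonal_swap (n := L) (f := fun p => commCoeff θ n p.1 p.2)
  have h2 : ∀ p : ℕ × ℕ, commCoeff θ n p.swap.1 p.swap.2 = - commCoeff θ n p.1 p.2 := by
    rintro ⟨i, j⟩
    simp only [commCoeff, Prod.swap]
    ring
  simp only [h2, Finset.sum_neg_distrib] at h
  linarith

/-- The weight, of order `n` in the bulk, penalises antidiagonals far from the mean, so that
Cauchy–Schwarz over `L` sees only about `√n` of them. -/
lemma sum_weighted_commCoeff_sq_le {θ : ℝ} (h0 : 0 < θ) (h1 : θ < 1) (n : ℕ) :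
    ∑ L ∈ Finset.range (2 * (n + 2)),
      (((n + 1 : ℕ) : ℝ) + (L - 2 * ((n + 1 : ℕ) * θ)) ^ 2) *
        ∑ i ∈ Finset.range (L + 1), commCoeff θ n i (L - i) ^ 2 ≤
      7 / (θ * (1 - θ) * (1 - θ) ^ 2) * (1 / (n + 1 : ℕ)) := by
  set m : ℝ := ((n + 1 : ℕ) : ℝ) with hm
  have hm0 : 0 < m := by rw [hm]; positivity
  have hσ : 0 < θ * (1 - θ) := mul_pos h0 (by linarith)
  have h1' : 0 < 1 - θ := by linarith
  have hre : ∑ L ∈ Finset.range (2 * (n + 2)), (m + (L - 2 * (m * θ)) ^ 2) *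
        ∑ i ∈ Finset.range (L + 1), commCoeff θ n i (L - i) ^ 2 =
      ∑ i ∈ Finset.range (n + 2), ∑ j ∈ Finset.range (n + 2),
        (m + (((i + j : ℕ) : ℝ) - 2 * (m * θ)) ^ 2) * commCoeff θ n i j ^ 2 := by
    rw [sum_range_mul_range_eq (n + 2) (fun i j =>
      (m + (((i + j : ℕ) : ℝ) - 2 * (m * θ)) ^ 2) * commCoeff θ n i j ^ 2)]
    · refine Finset.sum_congr rfl fun L _ => ?_
      rw [Finset.mul_sum]
      refine Finset.sum_congr rfl fun i hi => ?_
      rw [Nat.add_sub_cancel' (by have := Finset.mem_range.1 hi; omega)]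
    · intro i j h
      rw [commCoeff_eq_zero h]
      ring
  have hb : ∀ i, binWeight θ (n + 1) i ≤ 1 / Real.sqrt (m * (θ * (1 - θ))) := by
    intro i
    refine (binWeight_le h0 h1 (n + 1) i).trans ?_
    rw [← hm]
    gcongr
    linarith
  have hbn : ∀ i, 0 ≤ binWeight θ (n + 1) i := binWeight_nonneg h0.le h1.le _
  set D : ℝ := 1 / (m * (θ * (1 - θ))) * (1 / (m * (1 - θ)) ^ 2) with hD
  have hD0 : 0 ≤ D := by rw [hD]; positivity
  have hterm : ∀ i j : ℕ, (m + (((i + j : ℕ) : ℝ) - 2 * (m * θ)) ^ 2) * commCoeff θ n i j ^ 2 ≤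
      D * (binWeight θ (n + 1) i * (binWeight θ (n + 1) j *
        ((2 * m * (i - m * θ) ^ 2 + (i - m * θ) ^ 4) +
          (2 * m * (j - m * θ) ^ 2 + (j - m * θ) ^ 4)))) := by
    intro i j
    set X := binWeight θ (n + 1) i
    set Y := binWeight θ (n + 1) j
    have hX := hbn i
    have hY := hbn j
    have hc : commCoeff θ n i j = (i - j) * (X * Y) / (m * (1 - θ)) := by
      rw [eq_div_iff (by positivity), ← binWeight_commutator, commCoeff, hm]
      push_cast; ring
    have hXY : X * Y ≤ 1 / (m * (θ * (1 - θ))) := by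
      calc X * Y ≤ 1 / Real.sqrt (m * (θ * (1 - θ))) * (1 / Real.sqrt (m * (θ * (1 - θ)))) :=
            mul_le_mul (hb i) (hb j) hY (by positivity)
        _ = _ := by rw [div_mul_div_comm, one_mul, Real.mul_self_sqrt (by positivity)]
    -- In centred variables the left side is `m (x - y)^2 + (x^2 - y^2)^2`, so second and fourth
    -- central moments suffice.
    have hpoly : (m + (((i + j : ℕ) : ℝ) - 2 * (m * θ)) ^ 2) * ((i : ℝ) - j) ^ 2 ≤
        (2 * m * (i - m * θ) ^ 2 + (i - m * θ) ^ 4) +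
          (2 * m * (j - m * θ) ^ 2 + (j - m * θ) ^ 4) := by
      set x := (i : ℝ) - m * θ with hx
      set y := (j : ℝ) - m * θ with hy
      have e1 : ((i + j : ℕ) : ℝ) - 2 * (m * θ) = x + y := by rw [hx, hy]; push_cast; ring
      have e2 : (i : ℝ) - j = x - y := by rw [hx, hy]; ring
      rw [e1, e2]
      nlinarith [mul_nonneg hm0.le (sq_nonneg (x + y)), sq_nonneg (x * y)]
    calc (m + (((i + j : ℕ) : ℝ) - 2 * (m * θ)) ^ 2) * commCoeff θ n i j ^ 2
        = ((m + (((i + j : ℕ) : ℝ) - 2 * (m * θ)) ^ 2) * ((i : ℝ) - j) ^ 2) *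
          ((X * Y) * (X * Y) * (1 / (m * (1 - θ)) ^ 2)) := by
          rw [hc]; generalize m * (1 - θ) = e; ring
      _ ≤ ((2 * m * (i - m * θ) ^ 2 + (i - m * θ) ^ 4) +
          (2 * m * (j - m * θ) ^ 2 + (j - m * θ) ^ 4)) *
          ((X * Y) * (1 / (m * (θ * (1 - θ)))) * (1 / (m * (1 - θ)) ^ 2)) := by gcongr
      _ = _ := by rw [hD]; ring
  rw [hre]
  refine (Finset.sum_le_sum fun i _ => Finset.sum_le_sum fun j _ => hterm i j).trans ?_
  simp only [← Finset.mul_sum]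
  simp only [← binExp_eq_sum_of_lt (show n + 1 < n + 2 by omega)]
  simp only [binExp_add, binExp_const, binExp_mul]
  have h2 := binExp_central_sq (θ := θ) (n + 1)
  have h4 := binExp_central_four_le h0.le h1.le (n + 1)
  rw [← hm] at h2 h4
  rw [h2]
  have hs1 : θ * (1 - θ) ≤ 1 / 4 := by nlinarith [sq_nonneg (θ - 1 / 2)]
  have hs2 : 2 * m * (m * (θ * (1 - θ))) ≤ 2 * m * (m * (1 / 4)) := by gcongr
  -- Each of the two indices contributes at most `m^2 / 2 + 3 m^2`.
  calc _ ≤ D * (7 * m ^ 2) := by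
        gcongr
        nlinarith
    _ = _ := by
        rw [hD]
        field_simp

lemma sum_sqrt_commCoeff_le {θ : ℝ} (h0 : 0 < θ) (h1 : θ < 1) :
    ∃ K : ℝ, 0 < K ∧ ∀ n : ℕ, ∑ L ∈ Finset.range (2 * (n + 2)),
      Real.sqrt (∑ i ∈ Finset.range (L + 1), commCoeff θ n i (L - i) ^ 2) ≤
      K * ((n + 1 : ℕ) : ℝ) ^ (-(3 / 4) : ℝ) := by
  have h1' : 0 < 1 - θ := by linarith
  set K' : ℝ := 7 / (θ * (1 - θ) * (1 - θ) ^ 2) with hK'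
  have hK0 : 0 < K' := by rw [hK']; positivity
  refine ⟨1 / 2 * (4 * Real.pi + K'), by positivity, fun n => ?_⟩
  have hw := sum_weighted_commCoeff_sq_le h0 h1 n
  set m : ℝ := ((n + 1 : ℕ) : ℝ) with hm
  have hm1 : 1 ≤ m := by rw [hm]; exact_mod_cast Nat.le_add_left 1 n
  have hm0 : 0 < m := by linarith
  -- With `w` the weight and `c` the inner sum, `√c ≤ (k / w + w c / k) / 2`. The sums of `1 / w`
  -- and `w c` are of orders `m^(-1/2)` and `m^(-1)`, and this `k` balances them.
  set k : ℝ := m ^ (-(1 / 4) : ℝ) with hk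
  have hk0 : 0 < k := Real.rpow_pos_of_pos hm0 _
  have hinv := sum_inv_add_sq_le (a := Real.sqrt m) (Real.one_le_sqrt.2 hm1) (2 * (m * θ))
    (2 * (n + 2))
  rw [Real.sq_sqrt hm0.le] at hinv
  have hpt : ∀ L : ℕ, Real.sqrt (∑ i ∈ Finset.range (L + 1), commCoeff θ n i (L - i) ^ 2) ≤
      1 / 2 * (k * (1 / (m + (L - 2 * (m * θ)) ^ 2)) + k⁻¹ * ((m + (L - 2 * (m * θ)) ^ 2) *
        ∑ i ∈ Finset.range (L + 1), commCoeff θ n i (L - i) ^ 2)) := by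
    intro L
    have hc : 0 ≤ ∑ i ∈ Finset.range (L + 1), commCoeff θ n i (L - i) ^ 2 :=
      Finset.sum_nonneg fun i _ => sq_nonneg _
    set c := ∑ i ∈ Finset.range (L + 1), commCoeff θ n i (L - i) ^ 2
    set w := m + ((L : ℝ) - 2 * (m * θ)) ^ 2 with hw
    have hw0 : 0 < w := by rw [hw]; positivity
    have hsq : Real.sqrt c ^ 2 = c := Real.sq_sqrt hc
    rw [← sub_nonneg]
    have : 1 / 2 * (k * (1 / w) + k⁻¹ * (w * c)) - Real.sqrt c =
        1 / 2 * (k⁻¹ * w⁻¹) * (k - w * Real.sqrt c) ^ 2 := by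
      nth_rewrite 1 [← hsq]
      field_simp
      ring
    rw [this]
    positivity
  refine (Finset.sum_le_sum fun L _ => hpt L).trans ?_
  rw [← Finset.mul_sum, Finset.sum_add_distrib, ← Finset.mul_sum, ← Finset.mul_sum]
  have e1 : k * (4 * Real.pi / Real.sqrt m) = 4 * Real.pi * m ^ (-(3 / 4) : ℝ) := by
    have : m ^ (-(3 / 4) : ℝ) = k * (Real.sqrt m)⁻¹ := by
      rw [hk, Real.sqrt_eq_rpow, ← Real.rpow_neg hm0.le, ← Real.rpow_add hm0]
      norm_num
    rw [this]; ring
  have e2 : k⁻¹ * (K' * (1 / m)) = K' * m ^ (-(3 / 4) : ℝ) := by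
    have : m ^ (-(3 / 4) : ℝ) = k⁻¹ * m⁻¹ := by
      rw [hk, ← Real.rpow_neg hm0.le, ← Real.rpow_neg_one m, ← Real.rpow_add hm0]
      norm_num
    rw [this]; ring
  calc _ ≤ 1 / 2 * (k * (4 * Real.pi / Real.sqrt m) + k⁻¹ * (K' * (1 / m))) := by gcongr
    _ = _ := by rw [e1, e2]; ring

lemma traceExp_commutator_eq_sum (h0 : 0 < q) (n : ℕ) (f : List Bool → ℝ) :
    traceExp q (zeroOnePow (n + 1)) (fun u => traceExp q (zeroOnePow n) (fun v =>
        f (u ++ false :: true :: v) - f (u ++ true :: false :: v))) -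
      traceExp q (zeroOnePow n) (fun u => traceExp q (zeroOnePow (n + 1)) (fun v =>
        f (u ++ false :: true :: v) - f (u ++ true :: false :: v))) =
      ∑ L ∈ Finset.range (2 * (n + 2)), ∑ i ∈ Finset.range (L + 1),
        commCoeff (1 - q ^ 2) n i (L - i) * defectExp q f i (L - i) := by
  have key : ∀ a b : ℕ, a < n + 2 → b < n + 2 →
      traceExp q (zeroOnePow a) (fun u => traceExp q (zeroOnePow b) (fun v =>
        f (u ++ false :: true :: v) - f (u ++ true :: false :: v))) =
      ∑ i ∈ Finset.range (n + 2), ∑ j ∈ Finset.range (n + 2),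
        binWeight (1 - q ^ 2) a i * binWeight (1 - q ^ 2) b j * defectExp q f i j := by
    intro a b ha hb
    rw [traceExp_zeroOnePow h0, binExp_eq_sum_of_lt ha]
    refine Finset.sum_congr rfl fun i _ => ?_
    simp only [traceExp_zeroOnePow h0 b, binExp_eq_sum_of_lt hb]
    rw [wordExp_sum, Finset.mul_sum]
    refine Finset.sum_congr rfl fun j _ => ?_
    rw [wordExp_mul, mul_assoc]
    rfl
  rw [key _ _ (by omega) (by omega), key _ _ (by omega) (by omega), ← Finset.sum_sub_distrib,
    ← sum_range_mul_range_eq (n + 2) (fun i j => commCoeff (1 - q ^ 2) n i j * defectExp q f i j)]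
  · refine Finset.sum_congr rfl fun i _ => ?_
    rw [← Finset.sum_sub_distrib]
    refine Finset.sum_congr rfl fun j _ => ?_
    rw [commCoeff]; ring
  · intro i j h
    rw [commCoeff_eq_zero h, zero_mul]

theorem exists_tvDist_le (q : ℝ≥0) (hq0 : 0 < q) (hq1 : q < 1) :
    ∃ C : ℝ, 0 < C ∧ ∀ n : ℕ, 1 ≤ n →
      tvDist (traceLaw q hq1.le (xString n)) (traceLaw q hq1.le (yString n)) ≤
        C * (n : ℝ) ^ (-(3 / 4) : ℝ) := by
  have h0 : (0 : ℝ) < q := hq0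
  have h1 : (q : ℝ) < 1 := hq1
  have hp : 0 < 1 - (q : ℝ) := by linarith
  obtain ⟨K₁, hK₁, H₁⟩ := exists_abs_sum_defectExp_le h0 h1
  obtain ⟨K₂, hK₂, H₂⟩ := sum_sqrt_commCoeff_le (θ := 1 - (q : ℝ) ^ 2) (by nlinarith) (by nlinarith)
  refine ⟨1 / 2 * ((1 - q) ^ 2 * (K₁ * K₂)), by positivity, fun n hn => ?_⟩
  obtain ⟨n, rfl⟩ : ∃ m, n = m + 1 := ⟨n - 1, by omega⟩
  rw [mul_assoc (1 / 2 : ℝ)]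
  refine tvDist_le_of_forall q hq1.le _ _ _ fun f hf => ?_
  rw [traceExp_xString_sub_yString, traceExp_commutator_eq_sum h0, mul_assoc, mul_assoc]
  gcongr
  calc _ ≤ ∑ L ∈ Finset.range (2 * (n + 2)), K₁ *
        Real.sqrt (∑ i ∈ Finset.range (L + 1), commCoeff (1 - (q : ℝ) ^ 2) n i (L - i) ^ 2) := by
        refine Finset.sum_le_sum fun L _ => (le_abs_self _).trans ?_
        exact H₁ f hf L (fun i => commCoeff (1 - (q : ℝ) ^ 2) n i (L - i)) (sum_commCoeff _ n L)
    _ ≤ _ := by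
        rw [← Finset.mul_sum]
        gcongr
        exact H₂ n

end TraceReconstruction

/-! ### Exponential moments of martingale sums. -/

namespace TraceReconstruction

/-- The linear term integrates to zero against a centred increment, leaving a subgaussian factor. -/
lemma exp_le_add_exp_sq (x : ℝ) : Real.exp x ≤ x + Real.exp (x ^ 2) := by
  have h := Real.add_one_le_exp (x ^ 2)
  rcases le_total |x| 1 with hx | hx
  · have := (abs_le.1 (Real.abs_exp_sub_one_sub_id_le hx)).2
    linarith
  · rcases le_total 0 x with h0 | h0
    · rw [abs_of_nonneg h0] at hx
      have : Real.exp x ≤ Real.exp (x ^ 2) := Real.exp_le_exp.2 (by nlinarith)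
      linarith
    · rw [abs_of_nonpos h0] at hx
      have : Real.exp x ≤ 1 := Real.exp_le_one_iff.2 h0
      nlinarith

section words

variable {α : Type*}

lemma patSum_append (ψ : α → α → ℝ) (g : ℕ → ℝ) (c : α) (u w : List α) :
    patSum ψ g c (u ++ w) =
      patSum ψ g c u + patSum ψ (fun i => g (i + u.length)) (u.getLastD c) w := by
  induction u generalizing g c with
  | nil => simp [patSum]
  | cons a u ih =>
    simp only [List.cons_append, patSum, ih, List.getLastD_cons, List.length_cons, add_assoc]

variable [Fintype α] {ν : α → α → ℝ}

/-- Exponential moment of a martingale sum with bounded increments. -/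
lemma wordExp_exp_patSum_le (h0 : ∀ c d, 0 ≤ ν c d) (h1 : ∀ c, ∑ d, ν c d = 1)
    {ψ : α → α → ℝ} (hψ : ∀ c, ∑ d, ν c d * ψ c d = 0) (hB : ∀ c d, |ψ c d| ≤ 1)
    (t : ℝ) (L : ℕ) (c : α) (g : ℕ → ℝ) :
    wordExp ν L c (fun w => Real.exp (t * patSum ψ g c w)) ≤
      Real.exp (t ^ 2 * ∑ i ∈ Finset.range L, g i ^ 2) := by
  induction L generalizing c g with
  | zero => simp [patSum]
  | succ L ih =>
    rw [wordExp_succ, Finset.sum_range_succ', mul_add, Real.exp_add, mul_comm]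
    have hstep : ∀ d, wordExp ν L d (fun w => Real.exp (t * patSum ψ g c (d :: w))) ≤
        (t * g 0 * ψ c d + Real.exp (t ^ 2 * g 0 ^ 2)) *
          Real.exp (t ^ 2 * ∑ i ∈ Finset.range L, g (i + 1) ^ 2) := by
      intro d
      have hfun : (fun w => Real.exp (t * patSum ψ g c (d :: w))) =
          fun w => Real.exp (t * g 0 * ψ c d) *
            Real.exp (t * patSum ψ (fun i => g (i + 1)) d w) := by
        funext w
        rw [patSum, ← Real.exp_add]
        congr 1; ring
      rw [hfun, wordExp_mul]
      refine mul_le_mul ?_ (ih d fun i => g (i + 1)) (wordExp_nonneg h0 L d fun w =>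
        (Real.exp_pos _).le) ?_
      · refine (exp_le_add_exp_sq _).trans ?_
        have : ψ c d ^ 2 ≤ 1 := (sq_le_one_iff_abs_le_one _).2 (hB c d)
        have : (t * g 0 * ψ c d) ^ 2 ≤ t ^ 2 * g 0 ^ 2 := by
          have := mul_le_mul_of_nonneg_left this (sq_nonneg (t * g 0))
          linarith [mul_pow (t * g 0) (ψ c d) 2, mul_pow t (g 0) 2]
        gcongr
      · have h2 := exp_le_add_exp_sq (t * g 0 * ψ c d)
        have : ψ c d ^ 2 ≤ 1 := (sq_le_one_iff_abs_le_one _).2 (hB c d)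
        have : (t * g 0 * ψ c d) ^ 2 ≤ t ^ 2 * g 0 ^ 2 := by
          have := mul_le_mul_of_nonneg_left this (sq_nonneg (t * g 0))
          linarith [mul_pow (t * g 0) (ψ c d) 2, mul_pow t (g 0) 2]
        have := Real.exp_le_exp.2 this
        linarith [Real.exp_pos (t * g 0 * ψ c d)]
    refine (Finset.sum_le_sum fun d _ => mul_le_mul_of_nonneg_left (hstep d) (h0 c d)).trans
      (le_of_eq ?_)
    set X := Real.exp (t ^ 2 * ∑ i ∈ Finset.range L, g (i + 1) ^ 2)
    set Y := Real.exp (t ^ 2 * g 0 ^ 2)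
    calc _ = t * g 0 * X * ∑ d, ν c d * ψ c d + Y * X * ∑ d, ν c d := by
          simp only [Finset.mul_sum, ← Finset.sum_add_distrib]
          refine Finset.sum_congr rfl fun d _ => ?_
          ring
      _ = _ := by rw [h1, hψ]; ring

end words

/-! ### The flip statistic of a trace. -/

/-- The transition weights of the trace of an infinite alternating string. -/
noncomputable def flipWeight (q : ℝ) (c d : Bool) : ℝ :=
  if c = d then q / (1 + q) else 1 / (1 + q)

/-- The centred indicator that two consecutive bits differ. -/
noncomputable def flipStat (q : ℝ) (c d : Bool) : ℝ :=
  if c = d then -(1 / (1 + q)) else q / (1 + q)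

/-- The alternating string of length `N` following the bit `c`. -/
def alternating : ℕ → Bool → List Bool
  | 0, _ => []
  | N + 1, c => (!c) :: alternating N (!c)

lemma zeroOnePow_eq_alternating (n : ℕ) : zeroOnePow n = alternating (2 * n) true := by
  induction n with
  | zero => rfl
  | succ n ih => rw [zeroOnePow_succ, ih]; rfl

variable {q : ℝ}

lemma flipWeight_nonneg (h0 : 0 ≤ q) (c d : Bool) : 0 ≤ flipWeight q c d := by
  rw [flipWeight]; split_ifs <;> positivity

lemma sum_flipWeight (h0 : 0 ≤ q) (c : Bool) : ∑ d, flipWeight q c d = 1 := by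
  have : 1 + q ≠ 0 := by positivity
  have e : q / (1 + q) + 1 / (1 + q) = 1 := by rw [← add_div, add_comm, div_self this]
  cases c <;> simp only [flipWeight, Fintype.sum_bool, reduceCtorEq, if_true, if_false] <;>
    linarith

lemma sum_flipWeight_mul_flipStat (c : Bool) : ∑ d, flipWeight q c d * flipStat q c d = 0 := by
  cases c <;>
    simp only [flipWeight, flipStat, Fintype.sum_bool, reduceCtorEq, if_true, if_false] <;> ring

lemma abs_flipStat_le (h0 : 0 ≤ q) (c d : Bool) : |flipStat q c d| ≤ 1 := by
  have h : 0 < 1 + q := by positivity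
  rw [flipStat]
  split_ifs
  · rw [abs_neg, abs_of_nonneg (by positivity), div_le_one h]; linarith
  · rw [abs_of_nonneg (by positivity), div_le_one h]; linarith

lemma abs_flipStat_sub_le (h0 : 0 ≤ q) (c c' d : Bool) :
    |flipStat q c d - flipStat q c' d| ≤ 1 := by
  have h : 1 + q ≠ 0 := by positivity
  have e1 : -(1 / (1 + q)) - q / (1 + q) = -1 := by field_simp; ring
  have e2 : q / (1 + q) - -(1 / (1 + q)) = 1 := by field_simp; ring
  rw [flipStat, flipStat]
  split_ifs
  · simp
  · rw [e1]; simp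
  · rw [e2]; simp
  · simp

/-- The trace of an alternating string is dominated by the stationary chain. -/
lemma traceExp_alternating_le (h0 : 0 ≤ q) (h1 : q ≤ 1) (N : ℕ) (c : Bool) {f : List Bool → ℝ}
    (hf : ∀ s, 0 ≤ f s) : traceExp q (alternating N c) f ≤
      ∑ L ∈ Finset.range (N + 1), wordExp (flipWeight q) L c f := by
  induction N generalizing c f with
  | zero => simp [alternating]
  | succ N ih =>
    -- In an infinite alternating string the next surviving bit differs from the last with
    -- probability `(1-q)(1 + q^2 + q^4 + ...) = 1/(1+q)`. A finite trace `w` forces the infinite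
    -- trace to begin with `w`, hence the domination, with one chain for each length. The induction
    -- conditions on the fate of the first bit.
    rw [alternating, traceExp_cons]
    have a1 := ih (!c) hf
    have a2 := ih (!c) (f := fun t => f ((!c) :: t)) fun s => hf _
    have hp : 0 ≤ 1 - q := by linarith
    have hq : 0 < 1 + q := by positivity
    rw [Finset.sum_range_succ'] at a1 ⊢
    set P := fun L => wordExp (flipWeight q) L c (fun t => f (c :: t))
    set Q := fun L => wordExp (flipWeight q) L (!c) (fun t => f ((!c) :: t))
    have hP : ∀ L, 0 ≤ P L := fun L => wordExp_nonneg (flipWeight_nonneg h0) L _ fun w => hf _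
    have hQ : ∀ L, 0 ≤ Q L := fun L => wordExp_nonneg (flipWeight_nonneg h0) L _ fun w => hf _
    have e1 : ∀ L, wordExp (flipWeight q) (L + 1) (!c) f =
        1 / (1 + q) * P L + q / (1 + q) * Q L := by
      intro L
      rw [wordExp_succ, Fintype.sum_bool]
      cases c <;> simp [flipWeight, P, Q, add_comm]
    have e2 : ∀ L, wordExp (flipWeight q) (L + 1) c f =
        q / (1 + q) * P L + 1 / (1 + q) * Q L := by
      intro L
      rw [wordExp_succ, Fintype.sum_bool]
      cases c <;> simp [flipWeight, P, Q, add_comm]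
    simp only [e1, e2, wordExp_zero, Finset.sum_add_distrib, ← Finset.mul_sum] at a1 a2 ⊢
    rw [Finset.sum_range_succ P, Finset.sum_range_succ Q]
    change _ ≤ ∑ L ∈ Finset.range (N + 1), Q L at a2
    rw [Finset.sum_range_succ Q] at a2
    set SP := ∑ L ∈ Finset.range N, P L
    set SQ := ∑ L ∈ Finset.range N, Q L
    calc _ ≤ q * (1 / (1 + q) * SP + q / (1 + q) * SQ + f []) + (1 - q) * (SQ + Q N) := by
          gcongr
      _ = q / (1 + q) * SP + 1 / (1 + q) * SQ + (1 - q) * Q N + q * f [] := by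
          field_simp
          ring
      _ ≤ q / (1 + q) * SP + 1 / (1 + q) * SQ + 1 / (1 + q) * Q N + 1 * f [] := by
          have : 1 - q ≤ 1 / (1 + q) := by
            rw [le_div_iff₀ hq]; nlinarith
          have := hQ N
          have := hf []
          gcongr
      _ ≤ _ := by
          have := mul_nonneg (show 0 ≤ q / (1 + q) by positivity) (hP N)
          linarith

/-- Only the first summand sees the preceding bit. -/
lemma patSum_flipStat_start_le (h0 : 0 ≤ q) {g : ℕ → ℝ} {G : ℝ} (hG : ∀ i, |g i| ≤ G) (t : ℝ)
    (c c' : Bool) (v : List Bool) :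
    t * patSum (flipStat q) g c v ≤ |t| * G + t * patSum (flipStat q) g c' v := by
  have hG0 : 0 ≤ G := (abs_nonneg _).trans (hG 0)
  cases v with
  | nil => simp only [patSum]; have := mul_nonneg (abs_nonneg t) hG0; linarith
  | cons d v =>
    simp only [patSum]
    have : t * (g 0 * (flipStat q c d - flipStat q c' d)) ≤ |t| * G := by
      refine (le_abs_self _).trans ?_
      rw [abs_mul, abs_mul]
      gcongr
      calc |g 0| * |flipStat q c d - flipStat q c' d| ≤ G * 1 :=
            mul_le_mul (hG 0) (abs_flipStat_sub_le h0 c c' d) (abs_nonneg _) hG0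
        _ = G := mul_one G
    linarith

lemma traceExp_exp_patSum_zeroOnePow_le (h0 : 0 ≤ q) (h1 : q ≤ 1) {g : ℕ → ℝ} {G V : ℝ}
    (hG : ∀ i, |g i| ≤ G) (hV : ∀ L, ∑ i ∈ Finset.range L, g i ^ 2 ≤ V) (t : ℝ) (c : Bool)
    (n : ℕ) : traceExp q (zeroOnePow n) (fun v => Real.exp (t * patSum (flipStat q) g c v)) ≤
      Real.exp (|t| * G) * ((2 * n + 1) * Real.exp (t ^ 2 * V)) := by
  calc _ ≤ traceExp q (zeroOnePow n) (fun v => Real.exp (|t| * G) *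
        Real.exp (t * patSum (flipStat q) g true v)) := by
        refine traceExp_mono h0 h1 _ fun v => ?_
        rw [← Real.exp_add]
        exact Real.exp_le_exp.2 (patSum_flipStat_start_le h0 hG t c true v)
    _ ≤ _ := by
        rw [traceExp_mul, zeroOnePow_eq_alternating]
        gcongr
        refine (traceExp_alternating_le h0 h1 _ _ fun s => (Real.exp_pos _).le).trans ?_
        calc _ ≤ ∑ L ∈ Finset.range (2 * n + 1), Real.exp (t ^ 2 * V) := by
              refine Finset.sum_le_sum fun L _ => ?_
              refine (wordExp_exp_patSum_le (flipWeight_nonneg h0) (sum_flipWeight h0)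
                sum_flipWeight_mul_flipStat (abs_flipStat_le h0) t L true g).trans ?_
              gcongr
              exact hV L
          _ = _ := by simp

/-- The defect bits break the martingale structure; each one costs at most a factor `exp (|t| * G)`.
-/
lemma traceExp_exp_patSum_append_le (h0 : 0 ≤ q) (h1 : q ≤ 1) {g : ℕ → ℝ} {G : ℝ}
    (hG : ∀ i, |g i| ≤ G) (t : ℝ) (x u : List Bool) :
    traceExp q x (fun w => Real.exp (t * patSum (flipStat q) g true (u ++ w))) ≤
      Real.exp (|t| * G) ^ x.length * Real.exp (t * patSum (flipStat q) g true u) := by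
  have hG0 : 0 ≤ G := (abs_nonneg _).trans (hG 0)
  induction x generalizing u with
  | nil => simp
  | cons b x ih =>
    have h2 := ih (u ++ [b])
    simp only [List.append_assoc, List.cons_append, List.nil_append] at h2
    rw [traceExp_cons, List.length_cons, pow_succ, mul_assoc]
    set E := Real.exp (|t| * G) with hE
    have hE1 : 1 ≤ E := Real.one_le_exp (mul_nonneg (abs_nonneg t) hG0)
    have h3 : Real.exp (t * patSum (flipStat q) g true (u ++ [b])) ≤
        E * Real.exp (t * patSum (flipStat q) g true u) := by
      rw [hE, ← Real.exp_add, patSum_append]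
      refine Real.exp_le_exp.2 ?_
      simp only [patSum]
      have : t * (g (0 + u.length) * flipStat q (u.getLastD true) b) ≤ |t| * G := by
        refine (le_abs_self _).trans ?_
        rw [abs_mul, abs_mul]
        gcongr
        calc _ ≤ G * 1 := mul_le_mul (hG _) (abs_flipStat_le h0 _ _) (abs_nonneg _) hG0
          _ = G := mul_one G
      linarith
    set A := Real.exp (t * patSum (flipStat q) g true u)
    have hA : 0 < A := Real.exp_pos _
    have hp : 0 ≤ 1 - q := by linarith
    calc _ ≤ q * (E ^ x.length * A) + (1 - q) * (E ^ x.length * (E * A)) := by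
          gcongr
          · exact ih u
          · exact h2.trans (by gcongr)
      _ ≤ q * (E ^ x.length * (E * A)) + (1 - q) * (E ^ x.length * (E * A)) := by
          gcongr
          exact le_mul_of_one_le_left hA.le hE1
      _ = _ := by ring

/-- The fourth power counts the two defect bits and one change of preceding bit for each alternating
piece. The polynomial factors count the possible trace lengths of the pieces. -/
lemma traceExp_exp_patSum_defect_le (h0 : 0 ≤ q) (h1 : q ≤ 1) {g : ℕ → ℝ} {G V : ℝ}
    (hG : ∀ i, |g i| ≤ G) (hV : ∀ L, ∑ i ∈ Finset.range L, g i ^ 2 ≤ V) (t : ℝ) (a b : ℕ) :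
    traceExp q (zeroOnePow a ++ [true, false] ++ zeroOnePow b)
        (fun s => Real.exp (t * patSum (flipStat q) g true s)) ≤
      Real.exp (|t| * G) ^ 4 * ((2 * a + 1) * (2 * b + 1) * Real.exp (t ^ 2 * V) ^ 2) := by
  set E := Real.exp (|t| * G) with hE
  set W := Real.exp (t ^ 2 * V) with hW
  have hshift : ∀ k L, ∑ i ∈ Finset.range L, g (i + k) ^ 2 ≤ V := by
    intro k L
    have h := Finset.sum_range_add (fun i => g i ^ 2) k L
    have h2 : 0 ≤ ∑ i ∈ Finset.range k, g i ^ 2 := Finset.sum_nonneg fun i _ => sq_nonneg _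
    have := hV (k + L)
    simp only [add_comm _ k]
    linarith
  have hv : ∀ u, traceExp q (zeroOnePow b) (fun v =>
      Real.exp (t * patSum (flipStat q) g true (u ++ v))) ≤
      E * ((2 * b + 1) * W) * Real.exp (t * patSum (flipStat q) g true u) := by
    intro u
    have : (fun v => Real.exp (t * patSum (flipStat q) g true (u ++ v))) = fun v =>
        Real.exp (t * patSum (flipStat q) g true u) *
          Real.exp (t * patSum (flipStat q) (fun i => g (i + u.length)) (u.getLastD true) v) := by
      funext v
      rw [patSum_append, mul_add, Real.exp_add]
    rw [this, traceExp_mul, mul_comm]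
    gcongr
    exact traceExp_exp_patSum_zeroOnePow_le h0 h1 (fun i => hG _) (hshift _) t _ b
  rw [traceExp_append]
  refine (traceExp_mono h0 h1 _ hv).trans ?_
  rw [traceExp_mul, traceExp_append]
  have hm := traceExp_mono h0 h1 (zeroOnePow a)
    (traceExp_exp_patSum_append_le h0 h1 hG t [true, false])
  rw [traceExp_mul] at hm
  have hu := traceExp_exp_patSum_zeroOnePow_le h0 h1 hG hV t true a
  calc _ ≤ E * ((2 * b + 1) * W) * (E ^ 2 * (E * ((2 * a + 1) * W))) := by
        gcongr
        exact hm.trans (mul_le_mul_of_nonneg_left hu (by positivity))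
    _ = _ := by ring

/-! ### The gap between the means. -/

/-- The sign of the bit preceding the insertion point. -/
def bitSign (b : Bool) : ℝ := if b then 1 else -1

/-- Minus the sign of the first bit, and `0` for the empty string. -/
def headSign : List Bool → ℝ
  | [] => 0
  | b :: _ => -bitSign b

/-- Both inserted pairs flip internally at the same index, so only the two joints with `u` and `v`
differ. -/
lemma patSum_flipStat_commutator (h0 : 0 ≤ q) (g : ℕ → ℝ) (u v : List Bool) :
    patSum (flipStat q) g true (u ++ false :: true :: v) -
      patSum (flipStat q) g true (u ++ true :: false :: v) =
      g u.length * bitSign (u.getLastD true) + g (u.length + 2) * headSign v := by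
  have h : 1 + q ≠ 0 := by positivity
  rw [patSum_append, patSum_append]
  generalize u.getLastD true = c
  rcases v with _ | ⟨d, v⟩
  · cases c <;> simp [patSum, flipStat, bitSign, headSign] <;> field_simp <;> ring_nf
  · have e : u.length + 2 = 1 + 1 + u.length := by ring
    rw [e]
    cases c <;> cases d <;> simp [patSum, flipStat, bitSign, headSign] <;> field_simp <;> ring_nf

lemma traceExp_headSign_succ (n : ℕ) : traceExp q (zeroOnePow (n + 1)) headSign =
    q ^ 2 * traceExp q (zeroOnePow n) headSign + (1 - q) ^ 2 := by
  rw [zeroOnePow_succ, traceExp_append]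
  simp only [traceExp_cons, traceExp_nil, List.nil_append, List.cons_append, headSign, bitSign,
    traceExp_const]
  simp only [Bool.false_eq_true, if_true, if_false]
  change q * (q * traceExp q (zeroOnePow n) headSign + _) + _ = _
  ring

lemma traceExp_headSign_succ_sub (n : ℕ) : traceExp q (zeroOnePow (n + 1)) headSign -
    traceExp q (zeroOnePow n) headSign = (1 - q) ^ 2 * (q ^ 2) ^ n := by
  induction n with
  | zero => rw [traceExp_headSign_succ]; simp [zeroOnePow, headSign]
  | succ n ih =>
    rw [traceExp_headSign_succ, pow_succ]
    nth_rewrite 2 [traceExp_headSign_succ]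
    linear_combination q ^ 2 * ih

lemma traceExp_headSign_nonneg (n : ℕ) : 0 ≤ traceExp q (zeroOnePow n) headSign := by
  induction n with
  | zero => simp [zeroOnePow, headSign]
  | succ n ih => rw [traceExp_headSign_succ]; positivity

/-- Condition on the trace of the last `01`: the traces `0` and `1` have equal length and
probability and opposite signs, so they cancel. -/
lemma traceExp_lastSign_succ (g : ℕ → ℝ) (n : ℕ) :
    traceExp q (zeroOnePow (n + 1)) (fun u => g u.length * bitSign (u.getLastD true)) =
      q ^ 2 * traceExp q (zeroOnePow n) (fun u => g u.length * bitSign (u.getLastD true)) +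
        (1 - q) ^ 2 * traceExp q (zeroOnePow n) (fun u => g (u.length + 2)) := by
  rw [zeroOnePow_succ', traceExp_append, ← traceExp_mul, ← traceExp_mul, ← traceExp_add]
  congr 1
  funext u
  simp only [traceExp_cons, traceExp_nil, List.append_nil, List.getLastD_concat, List.length_append,
    List.length_cons, List.length_nil]
  rw [show u ++ [false, true] = (u ++ [false]) ++ [true] by simp, List.getLastD_concat]
  simp only [bitSign, Bool.false_eq_true, if_true, if_false]
  ring

/-- The main term is the growth of the mean weight at the defect, times the bias of the following
piece to begin with `0`. Boundary effects decay like `(q^2)^k`. -/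
lemma traceExp_patSum_sub_ge (h0 : 0 ≤ q) (h1 : q ≤ 1) {g : ℕ → ℝ} {G δ : ℝ}
    (hg0 : ∀ i, 0 ≤ g i) (hG : ∀ i, g i ≤ G) (n k : ℕ) (hk : k ≤ n + 1)
    (hD : ∀ j, n + 1 ≤ j + k → j ≤ n + 1 →
      δ ≤ traceExp q (zeroOnePow (j + 1)) (fun u => g (u.length + 2)) -
        traceExp q (zeroOnePow j) (fun u => g (u.length + 2))) (hδ : 0 ≤ δ) :
    (1 - q) ^ 2 * ((1 - q) ^ 2 * δ - (q ^ 2) ^ k * (3 * G)) ≤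
      traceExp q (xString (n + 2)) (patSum (flipStat q) g true) -
        traceExp q (yString (n + 2)) (patSum (flipStat q) g true) := by
  set A := fun n => traceExp q (zeroOnePow n) (fun u => g u.length * bitSign (u.getLastD true))
    with hA
  set M := fun n => traceExp q (zeroOnePow n) (fun u => g (u.length + 2)) with hM
  set κ := fun n => traceExp q (zeroOnePow n) headSign with hκ
  have hG0 : 0 ≤ G := (hg0 0).trans (hG 0)
  have hM0 : ∀ n, 0 ≤ M n := fun n => traceExp_nonneg h0 h1 _ fun u => hg0 _
  have hMG : ∀ n, M n ≤ G := fun n => by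
    rw [← traceExp_const (q := q) (zeroOnePow n) G]
    exact traceExp_mono h0 h1 _ fun u => hG _
  have hsign : ∀ i b, -G ≤ g i * bitSign b ∧ g i * bitSign b ≤ G := by
    intro i b
    have := hg0 i
    have := hG i
    cases b <;> simp [bitSign] <;> constructor <;> linarith
  have hAG : ∀ n, A n ≤ G := fun n => by
    rw [← traceExp_const (q := q) (zeroOnePow n) G]
    exact traceExp_mono h0 h1 _ fun u => (hsign _ _).2
  have hAG' : ∀ n, -G ≤ A n := fun n => by
    rw [← traceExp_const (q := q) (zeroOnePow n) (-G)]
    exact traceExp_mono h0 h1 _ fun u => (hsign _ _).1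
  have hAs : ∀ n, A (n + 1) = q ^ 2 * A n + (1 - q) ^ 2 * M n := traceExp_lastSign_succ g
  have hF : ∀ a b : ℕ, traceExp q (zeroOnePow a) (fun u => traceExp q (zeroOnePow b) (fun v =>
      patSum (flipStat q) g true (u ++ false :: true :: v) -
        patSum (flipStat q) g true (u ++ true :: false :: v))) = A a + κ b * M a := by
    intro a b
    simp only [patSum_flipStat_commutator h0, traceExp_add, traceExp_mul, traceExp_const]
    simp only [mul_comm _ (traceExp q (zeroOnePow b) headSign), traceExp_mul]
    rfl
  -- The recursion for `A` contracts negative increments by `q^2`, since `M` increases over this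
  -- range. Starting `k` steps back, where the increment is at least `-2G`, makes the final loss
  -- exponentially small.
  have hdesc : ∀ i, i ≤ k → -((q ^ 2) ^ i * (2 * G)) ≤ A (n + 1 - k + i + 1) - A (n + 1 - k + i) := by
    intro i hi
    induction i with
    | zero => have := hAG (n + 1 - k); have := hAG' (n + 1 - k + 1); simp; linarith
    | succ i ih =>
      have h3 := hD (n + 1 - k + i) (by omega) (by omega)
      have h4 := ih (by omega)
      rw [show n + 1 - k + (i + 1) = n + 1 - k + i + 1 by ring, hAs (n + 1 - k + i + 1)]
      nth_rewrite 2 [hAs (n + 1 - k + i)]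
      have h5 := mul_le_mul_of_nonneg_left h4 (sq_nonneg q)
      have h6 : 0 ≤ (1 - q) ^ 2 * (M (n + 1 - k + i + 1) - M (n + 1 - k + i)) :=
        mul_nonneg (sq_nonneg _) (hδ.trans h3)
      rw [pow_succ]
      linarith
  have hlast := hdesc k le_rfl
  rw [Nat.sub_add_cancel hk] at hlast
  rw [traceExp_xString_sub_yString, hF, hF]
  have hκ1 : κ (n + 2) - κ (n + 1) = (1 - q) ^ 2 * (q ^ 2) ^ (n + 1) :=
    traceExp_headSign_succ_sub (n + 1)
  have hκ2 : (1 - q) ^ 2 ≤ κ (n + 1) := by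
    simp only [hκ]
    rw [traceExp_headSign_succ]
    have := mul_nonneg (sq_nonneg q) (traceExp_headSign_nonneg (q := q) n)
    linarith
  have hDn : δ ≤ M (n + 2) - M (n + 1) := hD (n + 1) (by omega) le_rfl
  refine mul_le_mul_of_nonneg_left ?_ (sq_nonneg _)
  have e : A (n + 1 + 1) + κ (n + 1) * M (n + 1 + 1) - (A (n + 1) + κ (n + 1 + 1) * M (n + 1)) =
      (A (n + 1 + 1) - A (n + 1)) + κ (n + 1) * (M (n + 2) - M (n + 1)) -
        (κ (n + 2) - κ (n + 1)) * M (n + 1) := by ring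
  rw [e, hκ1]
  have b1 : (1 - q) ^ 2 * δ ≤ κ (n + 1) * (M (n + 2) - M (n + 1)) :=
    mul_le_mul hκ2 hDn hδ (traceExp_headSign_nonneg _)
  have b2 : (1 - q) ^ 2 * (q ^ 2) ^ (n + 1) * M (n + 1) ≤ 1 * (q ^ 2) ^ k * G := by
    have hq2 : q ^ 2 ≤ 1 := pow_le_one₀ h0 h1
    refine mul_le_mul (mul_le_mul (pow_le_one₀ (by linarith) (by linarith))
      (pow_le_pow_of_le_one (sq_nonneg q) hq2 hk) (by positivity) zero_le_one) (hMG _) (hM0 _)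
      (by positivity)
  linarith

end TraceReconstruction

/-! ### The tent weights and a constant gap. -/

namespace TraceReconstruction

/-- The tent function of height `2 * r` and slope `1` centred at `c`. -/
noncomputable def tent (c r : ℝ) (k : ℕ) : ℝ := max 0 (2 * r - |(k : ℝ) - c|)

lemma tent_nonneg (c r : ℝ) (k : ℕ) : 0 ≤ tent c r k := le_max_left _ _

lemma tent_le {r : ℝ} (hr : 0 ≤ r) (c : ℝ) (k : ℕ) : tent c r k ≤ 2 * r :=
  max_le (by linarith) (by linarith [abs_nonneg ((k : ℝ) - c)])

lemma tent_succ_sub_ge (c r : ℝ) (k : ℕ) : -1 ≤ tent c r (k + 1) - tent c r k := by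
  have h : |((k + 1 : ℕ) : ℝ) - c| ≤ |(k : ℝ) - c| + 1 := by
    have := abs_add_le ((k : ℝ) - c) 1
    rw [abs_one] at this
    rwa [show ((k + 1 : ℕ) : ℝ) - c = (k : ℝ) - c + 1 by push_cast; ring]
  have h1 : tent c r k ≤ tent c r (k + 1) + 1 := by
    refine max_le ?_ ?_
    · linarith [tent_nonneg c r (k + 1)]
    · linarith [le_max_right 0 (2 * r - |((k + 1 : ℕ) : ℝ) - c|), tent.eq_1 c r (k + 1)]
  linarith

lemma tent_succ_sub_eq {c r : ℝ} {k : ℕ} (h1 : c - 2 * r ≤ k) (h2 : (k : ℝ) + 1 ≤ c) :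
    tent c r (k + 1) - tent c r k = 1 := by
  rw [tent, tent, abs_of_nonpos (by push_cast; linarith), abs_of_nonpos (by linarith),
    max_eq_right (by push_cast; linarith), max_eq_right (by linarith)]
  push_cast; ring

/-- On its support the squared tent is dominated by a multiple of the Cauchy kernel already summed.
-/
lemma sum_tent_sq_le {r : ℝ} (hr : 1 ≤ r) (c : ℝ) (L : ℕ) :
    ∑ k ∈ Finset.range L, tent c r k ^ 2 ≤ 320 * r ^ 3 := by
  have hr0 : 0 < r := by linarith
  have hpt : ∀ k : ℕ, tent c r k ^ 2 ≤ 20 * r ^ 4 * (1 / (r ^ 2 + ((k : ℝ) - c) ^ 2)) := by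
    intro k
    rcases le_total (2 * r) |(k : ℝ) - c| with h | h
    · rw [tent, max_eq_left (by linarith), zero_pow two_ne_zero]
      positivity
    · have h1 := tent_le hr0.le c k
      have h2 := tent_nonneg c r k
      have h3 : ((k : ℝ) - c) ^ 2 ≤ 4 * r ^ 2 := by
        rw [← sq_abs]; nlinarith [abs_nonneg ((k : ℝ) - c)]
      rw [mul_one_div, le_div_iff₀ (by positivity)]
      calc _ ≤ (2 * r) ^ 2 * (r ^ 2 + 4 * r ^ 2) := by gcongr
        _ = _ := by ring
  refine (Finset.sum_le_sum fun k _ => hpt k).trans ?_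
  rw [← Finset.mul_sum]
  calc _ ≤ 20 * r ^ 4 * (4 * Real.pi / r) := by
        gcongr
        exact sum_inv_add_sq_le hr c L
    _ = 80 * Real.pi * r ^ 3 := by field_simp; ring
    _ ≤ 80 * 4 * r ^ 3 := by gcongr; exact Real.pi_le_four
    _ = _ := by ring

/-- Chebyshev's inequality in the ramp of the tent. -/
lemma binExp_tent_step_ge {p s : ℝ} (h0 : 0 ≤ p) (h1 : p ≤ 1) (hs : 3 ≤ s) (N : ℕ)
    (hN : (N : ℝ) ≤ 2 * s ^ 2) (hN' : 2 * s ^ 2 ≤ N + s) :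
    3 / 4 ≤ binExp p N (fun i => tent (2 * s ^ 2 * p + 4 * s) (4 * s) (i + 3) -
      tent (2 * s ^ 2 * p + 4 * s) (4 * s) (i + 2)) := by
  have hs0 : 0 < s := by linarith
  -- The increasing ramp covers `2 s^2 p ± 4s`, with slope 1. Off the window `|i - N p| ≤ 2s` the
  -- parabola is at most `-1`, the least possible step.
  have hpt : ∀ i : ℕ, 1 - 1 / (2 * s ^ 2) * ((i : ℝ) - N * p) ^ 2 ≤
      tent (2 * s ^ 2 * p + 4 * s) (4 * s) (i + 3) -
      tent (2 * s ^ 2 * p + 4 * s) (4 * s) (i + 2) := by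
    intro i
    rcases le_total (2 * s) |(i : ℝ) - N * p| with h | h
    · refine le_trans ?_ (tent_succ_sub_ge _ _ (i + 2))
      have : 2 ≤ 1 / (2 * s ^ 2) * ((i : ℝ) - N * p) ^ 2 := by
        rw [one_div_mul_eq_div, le_div_iff₀ (by positivity), ← sq_abs ((i : ℝ) - N * p)]
        nlinarith
      linarith
    · have hup : (2 * s ^ 2 - N) * p ≤ s * 1 :=
        mul_le_mul (by linarith) h1 h0 hs0.le
      have hlo : 0 ≤ (2 * s ^ 2 - N) * p := mul_nonneg (by linarith) h0
      have h' := abs_le.1 h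
      rw [show i + 3 = i + 2 + 1 by ring, tent_succ_sub_eq]
      · have : 0 ≤ 1 / (2 * s ^ 2) * ((i : ℝ) - N * p) ^ 2 := by positivity
        linarith
      · push_cast; linarith [h'.1]
      · push_cast; linarith [h'.2]
  have h := binExp_mono h0 h1 N hpt
  refine le_trans ?_ h
  rw [binExp_sub, binExp_const, binExp_mul, binExp_central_sq]
  have h4 : p * (1 - p) ≤ 1 / 4 := by nlinarith [sq_nonneg (p - 1 / 2)]
  have h5 : (N : ℝ) * (p * (1 - p)) ≤ 2 * s ^ 2 * (1 / 4) :=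
    mul_le_mul hN h4 (mul_nonneg h0 (by linarith)) (by positivity)
  have h6 : 1 / (2 * s ^ 2) * ((N : ℝ) * (p * (1 - p))) ≤ 1 / 4 := by
    rw [one_div_mul_eq_div, div_le_iff₀ (by positivity)]
    linarith
  linarith

lemma exists_traceExp_tent_sub_ge {q : ℝ} (h0 : 0 ≤ q) (h1 : q < 1) :
    ∃ m₀ : ℕ, ∀ m : ℕ, m₀ ≤ m → (1 - q) ^ 5 ≤
      traceExp q (xString m) (patSum (flipStat q)
        (tent (2 * Real.sqrt m ^ 2 * (1 - q) + 4 * Real.sqrt m) (4 * Real.sqrt m)) true) -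
      traceExp q (yString m) (patSum (flipStat q)
        (tent (2 * Real.sqrt m ^ 2 * (1 - q) + 4 * Real.sqrt m) (4 * Real.sqrt m)) true) := by
  have hp : 0 < 1 - q := by linarith
  have hq2 : q ^ 2 < 1 := by nlinarith
  -- The error is `(q^2)^k * 3G` with `G = 8s` and `s ≤ 4k + 4`, hence the factor `96 (k + 1)`.
  have hlim : Filter.Tendsto (fun k : ℕ => 96 * ((k : ℝ) * (q ^ 2) ^ k + (q ^ 2) ^ k))
      Filter.atTop (nhds 0) := by
    have := ((tendsto_self_mul_const_pow_of_lt_one (sq_nonneg q) hq2).add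
      (tendsto_pow_atTop_nhds_zero_of_lt_one (sq_nonneg q) hq2)).const_mul 96
    simpa using this
  obtain ⟨k₀, hk₀⟩ := Filter.eventually_atTop.1
    (hlim.eventually (gt_mem_nhds (show 0 < (1 - q) ^ 3 / 2 by positivity)))
  refine ⟨(4 * k₀ + 4) ^ 2, fun m hm => ?_⟩
  have hsq : 4 * k₀ + 4 ≤ Nat.sqrt m := Nat.le_sqrt'.2 hm
  set k := Nat.sqrt m / 4 with hk
  have hkk : k₀ ≤ k := by omega
  have hkm : k + 2 ≤ m := by
    have := Nat.sqrt_le_self m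
    omega
  obtain ⟨n, rfl⟩ : ∃ n, m = n + 2 := ⟨m - 2, by omega⟩
  set s := Real.sqrt ((n + 2 : ℕ) : ℝ) with hs
  have hs2 : s ^ 2 = n + 2 := by
    rw [hs, Real.sq_sqrt (by positivity)]; push_cast; ring
  have hsl : ((Nat.sqrt (n + 2) : ℕ) : ℝ) ≤ s := Real.nat_sqrt_le_real_sqrt
  have hsu : s ≤ Nat.sqrt (n + 2) + 1 := Real.real_sqrt_le_nat_sqrt_succ
  have hsk : s ≤ 4 * k + 4 := by
    have : Nat.sqrt (n + 2) + 1 ≤ 4 * k + 4 := by omega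
    have : ((Nat.sqrt (n + 2) : ℕ) : ℝ) + 1 ≤ 4 * k + 4 := by exact_mod_cast this
    linarith
  have hks : (2 * k + 2 : ℝ) ≤ s := by
    have : 2 * k + 2 ≤ Nat.sqrt (n + 2) := by omega
    have : (2 * k + 2 : ℝ) ≤ (Nat.sqrt (n + 2) : ℕ) := by exact_mod_cast this
    linarith
  have hs3 : 3 ≤ s := by
    have : 4 ≤ Nat.sqrt (n + 2) := by omega
    have : (4 : ℝ) ≤ (Nat.sqrt (n + 2) : ℕ) := by exact_mod_cast this
    linarith
  set g := tent (2 * s ^ 2 * (1 - q) + 4 * s) (4 * s) with hg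
  -- One more period adds two bits, each raising the mean by at least `(1 - q) * (3/4)`.
  have hmain := traceExp_patSum_sub_ge h0 h1.le (g := g) (G := 2 * (4 * s))
    (δ := (1 - q) * (3 / 2)) (tent_nonneg _ _) (tent_le (by positivity) _) n k (by omega) ?_
    (by positivity)
  · refine le_trans ?_ hmain
    have hsmall := hk₀ k hkk
    have hX : 0 ≤ (q ^ 2) ^ k := by positivity
    have : (q ^ 2) ^ k * (3 * (2 * (4 * s))) ≤ (q ^ 2) ^ k * (3 * (2 * (4 * (4 * k + 4)))) := by
      gcongr
    calc (1 - q) ^ 5 = (1 - q) ^ 2 * ((1 - q) ^ 3) := by ring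
      _ ≤ _ := by
        gcongr
        nlinarith
  · intro j hj1 hj2
    rw [traceExp_length q (zeroOnePow (j + 1)) (fun i => g (i + 2)),
      traceExp_length q (zeroOnePow j) (fun i => g (i + 2)), length_zeroOnePow, length_zeroOnePow,
      show 2 * (j + 1) = 2 * j + 1 + 1 by ring, binExp_succ]
    have e1 := binExp_succ (θ := 1 - q) (2 * j) (fun i => g (i + 2))
    have hj1' : (n + 1 : ℝ) ≤ j + k := by exact_mod_cast hj1
    have hj2' : (j : ℝ) ≤ n + 1 := by exact_mod_cast hj2
    have s1 := binExp_tent_step_ge hp.le (by linarith) hs3 (2 * j)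
      (by push_cast; rw [hs2]; linarith) (by push_cast; rw [hs2]; linarith)
    have s2 := binExp_tent_step_ge hp.le (by linarith) hs3 (2 * j + 1)
      (by push_cast; rw [hs2]; linarith) (by push_cast; rw [hs2]; linarith)
    rw [binExp_sub] at s1 s2
    simp only [show ∀ i, i + 1 + 2 = i + 3 from fun i => rfl] at e1 ⊢
    nlinarith

/-! ### Truncation and the lower bound. -/

lemma exists_tvDist_ge (q : ℝ≥0) (hq1 : q < 1) :
    ∃ c : ℝ, 0 < c ∧ ∃ m₀ : ℕ, ∀ m : ℕ, m₀ ≤ m →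
      c * ((m : ℝ) ^ (-(3 / 4) : ℝ) * Real.log m ^ (-(1 / 2) : ℝ)) ≤
        tvDist (traceLaw q hq1.le (xString m)) (traceLaw q hq1.le (yString m)) := by
  have h0 : (0 : ℝ) ≤ q := q.2
  have h1 : (q : ℝ) < 1 := hq1
  obtain ⟨m₁, hm₁⟩ := exists_traceExp_tent_sub_ge h0 h1
  have hp : 0 < 1 - (q : ℝ) := by linarith
  set e : ℝ := (1 - (q : ℝ)) ^ 5 with he
  have he0 : 0 < e := by positivity
  set K : ℝ := 2 * (2 * (144 * (Real.exp 1 ^ 4 * 4))) with hK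
  obtain ⟨m₂, hm₂⟩ := exists_nat_gt (K / (e / 2))
  refine ⟨e / (4 * (6 * 144)), by positivity, max (max m₁ m₂) 3, fun m hm => ?_⟩
  have hm3 : 3 ≤ m := (le_max_right _ _).trans hm
  have hmm₁ : m₁ ≤ m := (le_max_left _ _).trans ((le_max_left _ _).trans hm)
  have hmm₂ : m₂ ≤ m := (le_max_right _ _).trans ((le_max_left _ _).trans hm)
  have hmain := hm₁ m hmm₁
  have hm3' : (3 : ℝ) ≤ m := by exact_mod_cast hm3
  have hm0 : (0 : ℝ) < m := by linarith
  set s := Real.sqrt (m : ℝ) with hs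
  have hs2 : s ^ 2 = m := Real.sq_sqrt hm0.le
  have hs1 : 1 ≤ s := Real.one_le_sqrt.2 (by linarith)
  have hs0 : 0 < s := by linarith
  set g := tent (2 * s ^ 2 * (1 - (q : ℝ)) + 4 * s) (4 * s) with hg
  set l := Real.log m with hl
  have hl1 : 1 ≤ l := by
    rw [hl, Real.le_log_iff_exp_le hm0]
    linarith [Real.exp_one_lt_d9]
  have hls : l ≤ 2 * s := by
    have h2 : l = 2 * Real.log s := by rw [hl, ← hs2, Real.log_pow]; norm_num
    have := Real.log_le_sub_one_of_pos hs0
    linarith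
  -- `320 * 4^3 ≤ 144^2`; a perfect square keeps `√V` explicit.
  set V : ℝ := 144 ^ 2 * s ^ 3 with hV
  have hV0 : 0 < V := by positivity
  have hVsum : ∀ L, ∑ i ∈ Finset.range L, g i ^ 2 ≤ V := by
    intro L
    refine (sum_tent_sq_le (by linarith) _ L).trans ?_
    rw [hV, mul_pow]
    have : 0 < s ^ 3 := by positivity
    linarith
  have hG : ∀ i, |g i| ≤ 8 * s := by
    intro i
    rw [abs_of_nonneg (tent_nonneg _ _ _)]
    refine (tent_le (by positivity) _ i).trans (by linarith)
  set t := Real.sqrt (l / V) with ht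
  have ht0 : 0 < t := Real.sqrt_pos.2 (by positivity)
  have ht2 : t ^ 2 = l / V := Real.sq_sqrt (by positivity)
  have htV : t ^ 2 * V = l := by rw [ht2]; field_simp
  have htG : t * (8 * s) ≤ 1 := by
    refine (abs_le_one_iff_mul_self_le_one.2 ?_ |> le_of_abs_le)
    calc t * (8 * s) * (t * (8 * s)) = t ^ 2 * (64 * s ^ 2) := by ring
      _ = l / (144 ^ 2 * s ^ 3) * (64 * s ^ 2) := by rw [ht2]
      _ ≤ 2 * s / (144 ^ 2 * s ^ 3) * (64 * s ^ 2) := by gcongr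
      _ = 128 / 144 ^ 2 := by field_simp; norm_num
      _ ≤ 1 := by norm_num
  have hexpl : Real.exp l = m := Real.exp_log hm0
  have hmoment : ∀ (τ : ℝ), |τ| = t → ∀ a b : ℕ, a ≤ m → b ≤ m →
      a + b + 1 ≤ 2 * m →
      traceExp q (zeroOnePow a ++ [true, false] ++ zeroOnePow b)
        (fun z => Real.exp (τ * patSum (flipStat q) g true z)) ≤
        Real.exp 1 ^ 4 * (4 * (m : ℝ) ^ 4) := by
    intro τ hτ a b ha hb hab
    refine (traceExp_exp_patSum_defect_le h0 h1.le hG hVsum τ a b).trans ?_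
    rw [hτ, ← sq_abs τ, hτ, htV, hexpl]
    have hab' : ((a : ℝ) + b + 1) ≤ 2 * m := by exact_mod_cast hab
    have hcoef : (2 * (a : ℝ) + 1) * (2 * b + 1) ≤ 4 * (m : ℝ) ^ 2 := by
      nlinarith [sq_nonneg ((a : ℝ) - b), a.cast_nonneg (α := ℝ), b.cast_nonneg (α := ℝ)]
    calc _ ≤ Real.exp 1 ^ 4 * (4 * (m : ℝ) ^ 2 * (m : ℝ) ^ 2) := by gcongr
      _ = _ := by ring
  -- The level gives a factor `m^(-6)` in the tail: the exponential moments use `m^4`, the prefactor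
  -- `t⁻¹` at most `144 m`, and one power is left for decay.
  set y := 6 * l / t with hy
  set k : List Bool → ℝ := fun z => t⁻¹ * Real.exp (-(6 * l)) *
    (Real.exp (t * patSum (flipStat q) g true z) + Real.exp (-t * patSum (flipStat q) g true z))
    with hk
  have hkb : ∀ a b : ℕ, a ≤ m → b ≤ m → a + b + 1 ≤ 2 * m →
      traceExp q (zeroOnePow a ++ [true, false] ++ zeroOnePow b) k ≤ K / 2 * (1 / m) := by
    intro a b ha hb hab
    have m1 := hmoment t (abs_of_pos ht0) a b ha hb hab
    have m2 := hmoment (-t) (by rw [abs_neg, abs_of_pos ht0]) a b ha hb hab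
    have hexp6 : Real.exp (-(6 * l)) = ((m : ℝ) ^ 6)⁻¹ := by
      rw [Real.exp_neg, show 6 * l = (6 : ℕ) * l by norm_num, Real.exp_nat_mul, hexpl]
    have htinv : t⁻¹ ≤ 144 * m := by
      rw [ht, ← Real.sqrt_inv, inv_div]
      refine Real.sqrt_le_iff.2 ⟨by positivity, ?_⟩
      calc V / l ≤ V / 1 := by gcongr
        _ = 144 ^ 2 * s ^ 3 := by rw [div_one, hV]
        _ ≤ 144 ^ 2 * s ^ 4 := by gcongr; norm_num
        _ = (144 * (s ^ 2)) ^ 2 := by ring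
        _ = _ := by rw [hs2]
    rw [hk, traceExp_mul, traceExp_add, hexp6]
    calc _ ≤ 144 * m * ((m : ℝ) ^ 6)⁻¹ * (Real.exp 1 ^ 4 * (4 * (m : ℝ) ^ 4) +
            Real.exp 1 ^ 4 * (4 * (m : ℝ) ^ 4)) := by
          refine mul_le_mul (by gcongr) (add_le_add m1 m2) (add_nonneg ?_ ?_) (by positivity) <;>
          exact traceExp_nonneg h0 h1.le _ fun z => (Real.exp_pos _).le
      _ = _ := by rw [hK]; field_simp; ring
  have hbound := traceExp_sub_le_tvDist q hq1.le (xString m) (yString m)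
    (patSum (flipStat q) g true) k y (fun z => by positivity) ?_
  · have kx : traceExp q (xString m) k ≤ K / 2 * (1 / m) := hkb _ _ (by omega) le_rfl (by omega)
    have ky : traceExp q (yString m) k ≤ K / 2 * (1 / m) := hkb _ _ le_rfl (by omega) (by omega)
    have hKm : K * (1 / m) ≤ e / 2 := by
      have : K / (e / 2) < m := hm₂.trans_le (by exact_mod_cast hmm₂)
      rw [div_lt_iff₀ (by positivity)] at this
      rw [mul_one_div, div_le_iff₀ hm0]
      linarith
    set d := tvDist (traceLaw q hq1.le (xString m)) (traceLaw q hq1.le (yString m))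
    have hyd : e / 4 ≤ y * d := by linarith
    have hyval : y = 6 * 144 * ((m : ℝ) ^ (3 / 4 : ℝ) * l ^ (1 / 2 : ℝ)) := by
      have hl0 : 0 < l := by linarith
      have hyl : y = 6 * Real.sqrt (V * l) := by
        have : Real.sqrt (V * l) * t = l := by
          rw [ht, ← Real.sqrt_mul (by positivity), show V * l * (l / V) = l ^ 2 by field_simp,
            Real.sqrt_sq hl0.le]
        rw [hy, div_eq_iff ht0.ne', mul_assoc, this]
      have hs3 : Real.sqrt (s ^ 3) = (m : ℝ) ^ (3 / 4 : ℝ) := by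
        rw [Real.sqrt_eq_rpow, hs, Real.sqrt_eq_rpow, ← Real.rpow_natCast, ← Real.rpow_mul hm0.le,
          ← Real.rpow_mul hm0.le]
        norm_num
      rw [hyl, hV, Real.sqrt_mul (by positivity), Real.sqrt_mul (by positivity),
        Real.sqrt_sq (by norm_num), hs3, Real.sqrt_eq_rpow]
      ring
    have hpos : 0 < (m : ℝ) ^ (3 / 4 : ℝ) * l ^ (1 / 2 : ℝ) := by positivity
    rw [Real.rpow_neg hm0.le, Real.rpow_neg (by linarith), ← mul_inv, ← div_eq_mul_inv,
      div_le_iff₀ hpos]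
    rw [hyval] at hyd
    rw [div_le_iff₀ (by norm_num)]
    linarith
  · intro z
    set T := patSum (flipStat q) g true z with hT
    have hexp : Real.exp (t * |T|) ≤ Real.exp (t * T) + Real.exp (-t * T) := by
      rcases abs_choice T with h | h
      · rw [h]; linarith [Real.exp_pos (-t * T)]
      · rw [h, mul_neg, ← neg_mul]; linarith [Real.exp_pos (t * T)]
    -- The excess over `y` is controlled by `x ≤ exp x`.
    have h2 : t * |T| - 6 * l ≤ Real.exp (-(6 * l)) * (Real.exp (t * T) + Real.exp (-t * T)) := by
      calc t * |T| - 6 * l ≤ Real.exp (t * |T| - 6 * l) := by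
            linarith [Real.add_one_le_exp (t * |T| - 6 * l)]
        _ = Real.exp (-(6 * l)) * Real.exp (t * |T|) := by rw [← Real.exp_add]; congr 1; ring
        _ ≤ _ := by gcongr
    have h3 : |T| - y = t⁻¹ * (t * |T| - 6 * l) := by rw [hy]; field_simp
    have h4 := mul_le_mul_of_nonneg_left h2 (inv_pos.2 ht0).le
    rw [← h3, ← mul_assoc] at h4
    linarith

/-- Finitely many exceptional indices are absorbed by shrinking the constant, as `v` is positive
there. -/
lemma exists_const_mul_le_of_eventually {u v : ℕ → ℝ} {a m : ℕ} {c : ℝ} (hc : 0 < c)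
    (hu : ∀ n, a ≤ n → 0 < u n) (hv : ∀ n, a ≤ n → 0 < v n)
    (h : ∀ n, a ≤ n → m ≤ n → c * u n ≤ v n) :
    ∃ c' : ℝ, 0 < c' ∧ ∀ n, a ≤ n → c' * u n ≤ v n := by
  induction m generalizing c with
  | zero => exact ⟨c, hc, fun n hn => h n hn n.zero_le⟩
  | succ m ih =>
    by_cases ham : a ≤ m
    · refine ih (lt_min hc (div_pos (hv m ham) (hu m ham))) fun n hn hmn => ?_
      rcases hmn.eq_or_lt with rfl | hlt
      · exact (le_div_iff₀ (hu m hn)).1 (min_le_right _ _)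
      · exact (mul_le_mul_of_nonneg_right (min_le_left _ _) (hu n hn).le).trans (h n hn hlt)
    · exact ⟨c, hc, fun n hn => h n hn (by omega)⟩

end TraceReconstruction

theorem proposition3 (q : ℝ≥0) (hq0 : 0 < q) (hq1 : q < 1) :
    ∃ C : ℝ, 0 < C ∧
      (∀ n : ℕ, 1 ≤ n →
        TraceReconstruction.tvDist
            (TraceReconstruction.traceLaw q hq1.le (TraceReconstruction.xString n))
            (TraceReconstruction.traceLaw q hq1.le (TraceReconstruction.yString n)) ≤
          C * (n : ℝ) ^ (-(3 / 4) : ℝ)) ∧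
      (∀ n : ℕ, 2 ≤ n →
        C⁻¹ * (n : ℝ) ^ (-(3 / 4) : ℝ) * (Real.log n) ^ (-(1 / 2) : ℝ) ≤
          TraceReconstruction.tvDist
            (TraceReconstruction.traceLaw q hq1.le (TraceReconstruction.xString n))
            (TraceReconstruction.traceLaw q hq1.le (TraceReconstruction.yString n))) := by
  obtain ⟨C₁, hC₁, H₁⟩ := TraceReconstruction.exists_tvDist_le q hq0 hq1
  obtain ⟨c, hc, m₀, h⟩ := TraceReconstruction.exists_tvDist_ge q hq1
  obtain ⟨c', hc', H₂⟩ := TraceReconstruction.exists_const_mul_le_of_eventually (a := 2) hc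
    (u := fun n => (n : ℝ) ^ (-(3 / 4) : ℝ) * Real.log n ^ (-(1 / 2) : ℝ))
    (v := fun n => TraceReconstruction.tvDist
      (TraceReconstruction.traceLaw q hq1.le (TraceReconstruction.xString n))
      (TraceReconstruction.traceLaw q hq1.le (TraceReconstruction.yString n)))
    (fun n hn => by
      have h1 : (1 : ℝ) < n := by exact_mod_cast hn
      have := Real.log_pos h1
      positivity)
    (fun n hn => by
      obtain ⟨n, rfl⟩ : ∃ k, n = k + 1 := ⟨n - 1, by omega⟩
      exact TraceReconstruction.tvDist_xString_yString_pos q hq1 n)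
    (fun n _ hn => h n hn)
  refine ⟨C₁ + c'⁻¹, by positivity, fun n hn => (H₁ n hn).trans ?_, fun n hn => ?_⟩
  · gcongr
    linarith [inv_pos.2 hc']
  · refine le_trans ?_ (H₂ n hn)
    have h1 : (1 : ℝ) < n := by exact_mod_cast hn
    have := Real.log_pos h1
    rw [mul_assoc]
    gcongr
    exact inv_le_of_inv_le₀ hc' (by linarith)
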